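/- Let $K$ be a field. A central arrangement $\mathcal{A}$ in $K^l$ is a finite set of linear hyperplanes of $K^l$. Its lattice of intersections $L(\mathcal{A})$ is the set of all intersections $\bigcap_{H\in\mathcal{B}}H$ with $\mathcal{B}\subseteq\mathcal{A}$ (the empty intersection being $K^l$), ordered by reverse inclusion. Put $S=K[x_1,\dots,x_l]$, and for each $H\in\mathcal{A}$ let $\alpha_H\in S$ be a linear form with $H=\alpha_H^{-1}(0)$. Let $$D(\mathcal{A})=\Big\{\delta=\sum_{i=1}^l f_i\,\partial_{x_i}\ \Big|\ f_i\in S,\ \delta(\alpha_H)\in\alpha_H S\text{ for all }H\in\mathcal{A}\Big\}.$$ The arrangement $\mathcal{A}$ is called free with exponents $(e_1,\dots,e_l)$ if the $S$-module $D(\mathcal{A})$ is free with a basis $\delta_1,\dots,\delta_l$ such that all coefficients of $\delta_i$ are homogeneous polynomials of degree $e_i$; it is called free if it is free with some exponents. We say that Terao's conjecture is true over $K$ if, for every $l$ and all central arrangements $\mathcal{A}^{(1)},\mathcal{A}^{(2)}$ in $K^l$ with $L(\mathcal{A}^{(1)})\cong L(\mathcal{A}^{(2)})$ as partially ordered sets,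 freeness of $\mathcal{A}^{(1)}$ implies freeness of $\mathcal{A}^{(2)}$. Theorem. If Terao's conjecture is true over $\mathbb{F}_p$ for every prime number $p$, then it is true over $\mathbb{Q}$. Moreover, in that case, for every $l$ and all central arrangements $\mathcal{A}^{(1)},\mathcal{A}^{(2)}$ in $\mathbb{Q}^l$ with $L(\mathcal{A}^{(1)})\cong L(\mathcal{A}^{(2)})$, if $\mathcal{A}^{(1)}$ is free with exponents $(e_1,\dots,e_l)$, then $\mathcal{A}^{(2)}$ is free with exponents $(e_1,\dots,e_l)$. -/

import Mathlib

/-- A central hyperplane arrangement in `K^l`: a finite set of linear hyperplanes of `K^l`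
(the coatoms of the lattice of linear subspaces are the subspaces of codimension one). -/
structure CentralArrangement (K : Type*) [Field K] (l : ℕ) where
  hyperplanes : Finset (Submodule K (Fin l → K))
  isCoatom_of_mem : ∀ H ∈ hyperplanes, IsCoatom H

/-- The homogeneous linear polynomial `a₁ x₁ + ⋯ + a_l x_l` in `K[x₁, …, x_l]`. -/
noncomputable def linearPoly {K : Type*} [Field K] {l : ℕ} (a : Fin l → K) :
    MvPolynomial (Fin l) K :=
  ∑ i, MvPolynomial.C (a i) * MvPolynomial.X i

/-- The zero locus `{v ∈ K^l | a₁ v₁ + ⋯ + a_l v_l = 0}` of `linearPoly a`. -/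
def linearLocus {K : Type*} [Field K] {l : ℕ} (a : Fin l → K) : Submodule K (Fin l → K) where
  carrier := {v | ∑ i, a i * v i = 0}
  add_mem' := by
    intro v w hv hw
    simp only [Set.mem_ofPred_eq, Pi.add_apply, mul_add, Finset.sum_add_distrib] at *
    rw [hv, hw, add_zero]
  zero_mem' := by simp
  smul_mem' := by
    intro c v hv
    simp only [Set.mem_ofPred_eq, Pi.smul_apply, smul_eq_mul] at *
    simp only [mul_left_comm _ c, ← Finset.mul_sum, hv, mul_zero]

namespace CentralArrangement

variable {K : Type*} [Field K] {l : ℕ}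

/-- The set `L(A)` of all intersections of subsets of `A`; the empty intersection is `K^l`. -/
def flats (A : CentralArrangement K l) : Set (Submodule K (Fin l → K)) :=
  {X | ∃ B : Finset (Submodule K (Fin l → K)), B ⊆ A.hyperplanes ∧ X = ⨅ H ∈ B, H}

/-- The lattice of intersections `L(A)`, ordered by reverse inclusion. -/
abbrev IntersectionLattice (A : CentralArrangement K l) : Type _ := (A.flats)ᵒᵈ

/-- The `K[x₁, …, x_l]`-module `D(A)` of logarithmic vector fields: the derivations `δ` of
`K[x₁, …, x_l]` with `δ α ∈ ⟨α⟩` for every linear form `α` defining a hyperplane of `A`.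
The defining form of a hyperplane is unique up to a nonzero scalar, so this is the same
as asking it for one chosen form per hyperplane. -/
def logVectorFields (A : CentralArrangement K l) :
    Submodule (MvPolynomial (Fin l) K)
      (Derivation K (MvPolynomial (Fin l) K) (MvPolynomial (Fin l) K)) where
  carrier := {δ | ∀ a : Fin l → K, linearLocus a ∈ A.hyperplanes →
    δ (linearPoly a) ∈ Ideal.span {linearPoly a}}
  add_mem' := by
    intro δ ε hδ hε a ha
    exact Ideal.add_mem _ (hδ a ha) (hε a ha)
  zero_mem' := by
    intro a _
    simp
  smul_mem' := by
    intro f δ hδ a ha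
    exact Ideal.mul_mem_left _ f (hδ a ha)

/-- `A` is free with exponents `(e₁, …, e_l)`: the module `D(A)` has a basis `δ₁, …, δ_l` over
`K[x₁, …, x_l]` such that `δ_i` is homogeneous of polynomial degree `e_i`, i.e. all its
coefficients `δ_i x_j` are homogeneous of degree `e_i`. -/
def IsFreeWithExponents (A : CentralArrangement K l) (e : Fin l → ℕ) : Prop :=
  ∃ δ : Module.Basis (Fin l) (MvPolynomial (Fin l) K) A.logVectorFields,
    ∀ i j, ((δ i : Derivation K (MvPolynomial (Fin l) K) (MvPolynomial (Fin l) K))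
      (MvPolynomial.X j)).IsHomogeneous (e i)

/-- `A` is free: it is free with some exponents. -/
def IsFree (A : CentralArrangement K l) : Prop :=
  ∃ e : Fin l → ℕ, A.IsFreeWithExponents e

end CentralArrangement

/-- Terao's conjecture over the field `K`: among central arrangements in `K^l` (for every `l`),
freeness depends only on the isomorphism class of the lattice of intersections. -/
def TeraoConjecture (K : Type*) [Field K] : Prop :=
  ∀ (l : ℕ) (A B : CentralArrangement K l),
    Nonempty (A.IntersectionLattice ≃o B.IntersectionLattice) → A.IsFree → B.IsFree

/-!
Let `A` and `B` be rational arrangements with isomorphic lattices of intersections, `A` free with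
exponents `e`. Choose integral linear forms defining them. Modulo every large prime `p` the forms
have the same linear dependencies as over `ℚ`, so they define arrangements `A_p` and `B_p` over
`𝔽_p` with unchanged lattices (`CentralArrangement.IsDefinedBy.eventually_exists_orderIso`).

*Freeness.* By Saito's criterion (`CentralArrangement.IsDefinedBy.isFreeWithExponents_iff`),
freeness with exponents `e` means that there are `l` homogeneous logarithmic vector fields of
degrees `e` whose determinant is a nonzero scalar times the product of the linear forms. Such fields
over `ℚ` reduce modulo every large `p`, hence `A_p` is free with exponents `e`, and by Terao's
conjecture over `𝔽_p` the arrangement `B_p` is free, with exponents `e'`, say. Conversely,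
homogeneous logarithmic fields of a fixed degree form the kernel of an integral linear map, and for
large `p` the kernel modulo `p` is the reduction of the integral kernel
(`exists_lift_isLogField`). As the exponents add up to the number of hyperplanes, only finitely many
degrees matter, and a basis of `D(B_p)` lifts to fields over `ℤ` satisfying Saito's criterion over
`ℚ`. So `B` is free with exponents `e'`.

*Exponents.* It remains to see that `e'` is a permutation of `e`. For all large `p` the
arrangements `A_p` and `B_p` are free with exponents `e` and `e'`. The number of points of
`𝔽_p^l` off the hyperplanes depends only on the lattice, by Möbius inversion
(`CentralArrangement.card_complement_eq`). For a free arrangement over `𝔽_p` it equals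
`∏ (p - e k)` (`CentralArrangement.IsDefinedBy.card_complement_eq_prod`): the vector field
`∑ (x_i ^ p - x_i) ∂_i` is logarithmic, hence a combination `∑ F_k δ_k` of the basis with
`deg F_k ≤ p - e k`, and the common zeros of the `F_k` in `𝔽_p^l` are exactly the points of the
complement. The `F_k` generate an ideal containing all `x_i ^ p - x_i`, so these zeros are simple,
and their number is computed by a version of Bézout's theorem (`card_zeros_eq_prod`), proved by
comparing Hilbert functions. The identity `∏ (p - e k) = ∏ (p - e' k)` for infinitely many `p`
gives the claim.
-/

open MvPolynomial

/-! ### Linear forms and their loci -/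

section LinearForms

variable {R : Type*} [CommRing R] {K : Type*} [Field K] {l : ℕ}

/-- The linear form with coefficient vector `a`, over any commutative ring. Over a field this is
`linearPoly a`. -/
noncomputable def linForm (a : Fin l → R) : MvPolynomial (Fin l) R :=
  ∑ i, C (a i) * X i

theorem linearPoly_eq_linForm (a : Fin l → K) : linearPoly a = linForm a := rfl

/-- The value on `linForm a` of the vector field with coefficients `f`. -/
noncomputable def applyField (a : Fin l → R) (f : Fin l → MvPolynomial (Fin l) R) :
    MvPolynomial (Fin l) R :=
  ∑ i, C (a i) * f i

theorem linForm_eq_applyField (a : Fin l → R) : linForm a = applyField a X := rfl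

theorem derivation_linForm (a : Fin l → R)
    (δ : Derivation R (MvPolynomial (Fin l) R) (MvPolynomial (Fin l) R)) :
    δ (linForm a) = applyField a fun j => δ (X j) := by
  simp [linForm, applyField, Derivation.leibniz]

theorem eval_linForm (a v : Fin l → R) : eval v (linForm a) = a ⬝ᵥ v := by
  simp [linForm, dotProduct]

theorem map_linForm {S : Type*} [CommRing S] (φ : R →+* S) (a : Fin l → R) :
    map φ (linForm a) = linForm (φ ∘ a) := by
  simp [linForm]

theorem map_applyField {S : Type*} [CommRing S] (φ : R →+* S) (a : Fin l → R)
    (f : Fin l → MvPolynomial (Fin l) R) :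
    map φ (applyField a f) = applyField (φ ∘ a) fun j => map φ (f j) := by
  simp [applyField]

theorem isHomogeneous_linForm (a : Fin l → R) : (linForm a).IsHomogeneous 1 :=
  IsHomogeneous.sum _ _ _ fun i _ => isHomogeneous_C_mul_X _ i

theorem coeff_linForm (a : Fin l → R) (i : Fin l) :
    coeff (Finsupp.single i 1) (linForm a) = a i := by
  classical
  simp [linForm, coeff_sum, coeff_C_mul, coeff_X, Finsupp.single_left_inj]

theorem linForm_ne_zero {a : Fin l → R} (ha : a ≠ 0) : linForm a ≠ 0 := by
  intro h
  apply ha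
  ext i
  rw [← coeff_linForm a i, h]
  simp

theorem irreducible_linForm {a : Fin l → K} (ha : a ≠ 0) : Irreducible (linForm a) := by
  apply irreducible_of_totalDegree_eq_one
  · exact (isHomogeneous_linForm a).totalDegree (linForm_ne_zero ha)
  · intro x hx
    obtain ⟨i, hi⟩ := Function.ne_iff.mp ha
    have h := hx (Finsupp.single i 1)
    rw [coeff_linForm] at h
    exact isUnit_iff_ne_zero.mpr fun h0 => hi (by simpa [h0] using h)

theorem mem_linearLocus {a v : Fin l → K} : v ∈ linearLocus a ↔ a ⬝ᵥ v = 0 := Iff.rfl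

theorem linearLocus_eq_ker (a : Fin l → K) :
    linearLocus a = LinearMap.ker (dotProductEquiv K (Fin l) a) := by
  ext v
  rw [mem_linearLocus, LinearMap.mem_ker]
  rfl

theorem linearLocus_zero : linearLocus (0 : Fin l → K) = ⊤ := by
  simp [linearLocus_eq_ker]

theorem isCoatom_linearLocus {a : Fin l → K} (ha : a ≠ 0) : IsCoatom (linearLocus a) := by
  rw [linearLocus_eq_ker]
  apply LinearMap.isCoatom_ker_of_surjective
  apply LinearMap.surjective_of_ne_zero
  simpa using ha

theorem exists_linearLocus_eq {H : Submodule K (Fin l → K)} (hH : IsCoatom H) :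
    ∃ a, linearLocus a = H := by
  obtain ⟨f, hf, hle⟩ := H.exists_le_ker_of_lt_top hH.lt_top
  refine ⟨(dotProductEquiv K (Fin l)).symm f, ?_⟩
  rw [linearLocus_eq_ker, LinearEquiv.apply_symm_apply]
  rcases hH.le_iff.mp hle with h | h
  · exact absurd (LinearMap.ker_eq_top.mp h) hf
  · exact h

/-- A linear form vanishes on an intersection of hyperplanes if and only if it is a linear
combination of the forms defining them. -/
theorem iInf_linearLocus_le_iff {ι : Type*} [Finite ι] (a : ι → Fin l → K) (b : Fin l → K) :
    ⨅ i, linearLocus (a i) ≤ linearLocus b ↔ b ∈ Submodule.span K (Set.range a) := by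
  constructor
  · intro h
    simp only [linearLocus_eq_ker] at h
    have := mem_span_of_iInf_ker_le_ker h
    have h2 := Submodule.mem_map_of_mem (f := (dotProductEquiv K (Fin l)).symm.toLinearMap) this
    rw [Submodule.map_span, ← Set.range_comp] at h2
    simpa [Function.comp_def] using h2
  · intro h v hv
    simp only [Submodule.mem_iInf, mem_linearLocus] at hv ⊢
    induction h using Submodule.span_induction with
    | mem x hx => obtain ⟨i, rfl⟩ := hx; exact hv i
    | zero => simp
    | add x y _ _ hx hy => rw [add_dotProduct, hx, hy, add_zero]
    | smul c x _ hx => rw [smul_dotProduct, hx, smul_zero]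

theorem linearLocus_le_iff {a b : Fin l → K} :
    linearLocus a ≤ linearLocus b ↔ ∃ c : K, c • a = b := by
  have := iInf_linearLocus_le_iff (fun _ : Unit => a) b
  simpa [Submodule.mem_span_singleton] using this

theorem linForm_smul (c : R) (a : Fin l → R) : linForm (c • a) = C c * linForm a := by
  simp [linForm, Finset.mul_sum, mul_assoc]

theorem applyField_smul (c : R) (a : Fin l → R) (f : Fin l → MvPolynomial (Fin l) R) :
    applyField (c • a) f = C c * applyField a f := by
  simp [applyField, Finset.mul_sum, mul_assoc]

theorem linearLocus_eq_of_associated {a b : Fin l → K}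
    (h : Associated (linForm a) (linForm b)) : linearLocus a = linearLocus b := by
  ext v
  obtain ⟨u, hu⟩ := h
  have := congrArg (eval v) hu
  rw [map_mul, eval_linForm, eval_linForm] at this
  have hu0 : eval v (u : MvPolynomial (Fin l) K) ≠ 0 := (u.isUnit.map (eval v)).ne_zero
  rw [mem_linearLocus, mem_linearLocus, ← this]
  simp [hu0]

end LinearForms

/-! ### Logarithmic vector fields and Saito's criterion -/

/-- The forms `linForm (a i)` define the hyperplanes of `A`, one form for each hyperplane. -/
structure CentralArrangement.IsDefinedBy {K : Type*} [Field K] {l : ℕ} {ι : Type*}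
    (A : CentralArrangement K l) (a : ι → Fin l → K) : Prop where
  injective : Function.Injective fun i => linearLocus (a i)
  mem_iff : ∀ H, H ∈ A.hyperplanes ↔ ∃ i, linearLocus (a i) = H

/-- The vector field with coefficients `f` is tangent to the zero loci of all the forms
`linForm (a i)`. This makes sense over any commutative ring. -/
def IsLogField {R : Type*} [CommRing R] {l : ℕ} {ι : Type*} (a : ι → Fin l → R)
    (f : Fin l → MvPolynomial (Fin l) R) : Prop :=
  ∀ i, linForm (a i) ∣ applyField (a i) f

section Saito

variable {K : Type*} [Field K] {l : ℕ} {ι : Type*}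
  {A : CentralArrangement K l} {a : ι → Fin l → K}

namespace CentralArrangement.IsDefinedBy

theorem ne_zero (h : A.IsDefinedBy a) (i : ι) : a i ≠ 0 := by
  intro h0
  have := (A.isCoatom_of_mem _ ((h.mem_iff _).mpr ⟨i, rfl⟩)).1
  rw [h0, linearLocus_zero] at this
  exact this rfl

theorem isRelPrime (h : A.IsDefinedBy a) {i j : ι} (hij : i ≠ j) :
    IsRelPrime (linForm (a i)) (linForm (a j)) := by
  rw [(irreducible_linForm (h.ne_zero i)).isRelPrime_iff_not_dvd]
  intro hd
  exact hij (h.injective (linearLocus_eq_of_associated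
    ((irreducible_linForm (h.ne_zero i)).associated_of_dvd (irreducible_linForm (h.ne_zero j)) hd)))

theorem mem_logVectorFields_iff (h : A.IsDefinedBy a)
    (δ : Derivation K (MvPolynomial (Fin l) K) (MvPolynomial (Fin l) K)) :
    δ ∈ A.logVectorFields ↔ IsLogField a fun j => δ (X j) := by
  change (∀ b : Fin l → K, linearLocus b ∈ A.hyperplanes →
    δ (linearPoly b) ∈ Ideal.span {linearPoly b}) ↔ _
  simp only [linearPoly_eq_linForm, Ideal.mem_span_singleton, derivation_linForm]
  constructor
  · intro H i
    exact H _ ((h.mem_iff _).mpr ⟨i, rfl⟩)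
  · intro H b hb
    obtain ⟨i, hi⟩ := (h.mem_iff _).mp hb
    obtain ⟨c, rfl⟩ := linearLocus_le_iff.mp hi.le
    rw [linForm_smul, applyField_smul]
    exact mul_dvd_mul_left _ (H i)

end CentralArrangement.IsDefinedBy

/-- A linear form divides the determinant of any matrix whose rows are vector fields tangent to
its zero locus. -/
theorem linForm_dvd_det {b : Fin l → K} (hb : b ≠ 0)
    (M : Matrix (Fin l) (Fin l) (MvPolynomial (Fin l) K))
    (hM : ∀ k, linForm b ∣ applyField b (M k)) : linForm b ∣ M.det := by
  obtain ⟨j, hj⟩ := Function.ne_iff.mp hb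
  choose q hq using hM
  have h1 := Matrix.det_updateCol_sum M j fun i => C (b i)
  have h2 : (fun k => ∑ i, (C (b i) : MvPolynomial (Fin l) K) • M k i) = linForm b • q := by
    ext1 k
    simpa [applyField] using hq k
  rw [h2, Matrix.det_updateCol_smul, smul_eq_mul] at h1
  have hu : IsUnit (C (b j) : MvPolynomial (Fin l) K) :=
    (isUnit_iff_ne_zero.mpr hj).map C
  exact (hu.dvd_mul_left).mp (Dvd.intro _ h1)

theorem prod_linForm_dvd_det [Fintype ι] (h : A.IsDefinedBy a)
    (M : Matrix (Fin l) (Fin l) (MvPolynomial (Fin l) K)) (hM : ∀ k, IsLogField a (M k)) :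
    ∏ i, linForm (a i) ∣ M.det :=
  Fintype.prod_dvd_of_isRelPrime (fun _ _ hij => h.isRelPrime hij)
    fun i => linForm_dvd_det (h.ne_zero i) M fun k => hM k i

theorem prod_linForm_ne_zero [Fintype ι] (h : A.IsDefinedBy a) : ∏ i, linForm (a i) ≠ 0 :=
  Finset.prod_ne_zero_iff.mpr fun i _ => linForm_ne_zero (h.ne_zero i)

end Saito

section SaitoCriterion

theorem Derivation.sum_smul_apply {R S ι : Type*} [CommRing R] [CommRing S] [Algebra R S]
    (s : Finset ι) (g : ι → S) (D : ι → Derivation R S S) (x : S) :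
    (∑ i ∈ s, g i • D i) x = ∑ i ∈ s, g i * D i x := by
  classical
  induction s using Finset.induction_on with
  | empty => simp
  | insert i s hi ih => rw [Finset.sum_insert hi, Finset.sum_insert hi, Derivation.add_apply, ih,
      Derivation.smul_apply, smul_eq_mul]

variable {K : Type*} [Field K] {l : ℕ} {ι : Type*} [Fintype ι]
  {A : CentralArrangement K l} {a : ι → Fin l → K}

theorem CentralArrangement.IsDefinedBy.det_ne_zero (h : A.IsDefinedBy a)
    {M : Matrix (Fin l) (Fin l) (MvPolynomial (Fin l) K)} {c : K}
    (hc : c ≠ 0) (hdet : M.det = C c * ∏ i, linForm (a i)) : M.det ≠ 0 := by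
  rw [hdet]
  exact mul_ne_zero (by simpa using hc) (prod_linForm_ne_zero h)

/-- Cramer's rule for vector fields: fields in `D(A)` whose coefficient determinant is a nonzero
multiple of the product of the linear forms generate `D(A)`. -/
theorem CentralArrangement.IsDefinedBy.exists_sum_mul_eq (h : A.IsDefinedBy a)
    {M : Matrix (Fin l) (Fin l) (MvPolynomial (Fin l) K)}
    (hM : ∀ k, IsLogField a (M k)) {c : K}
    (hc : c ≠ 0) (hdet : M.det = C c * ∏ i, linForm (a i))
    {d : Fin l → MvPolynomial (Fin l) K} (hd : IsLogField a d) :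
    ∃ q : Fin l → MvPolynomial (Fin l) K, (∀ j, ∑ k, q k * M k j = d j) ∧
      ∀ k, q k * M.det = (M.updateRow k d).det := by
  have hP := prod_linForm_ne_zero h
  have hq : ∀ k, ∏ i, linForm (a i) ∣ (M.updateRow k d).det := by
    intro k
    apply prod_linForm_dvd_det h
    intro k'
    by_cases hk : k' = k
    · subst hk
      simpa using hd
    · simpa [Matrix.updateRow_ne hk] using hM k'
  choose q hq using hq
  have hcr := Matrix.mulVec_cramer M.transpose d
  have hcr2 : Matrix.cramer M.transpose d = (∏ i, linForm (a i)) • q := by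
    ext1 k
    rw [Matrix.cramer_transpose_apply, hq]
    rfl
  rw [hcr2, Matrix.mulVec_smul, Matrix.det_transpose, hdet, mul_comm, mul_smul] at hcr
  have hcr3 : M.transpose.mulVec q = (C c : MvPolynomial (Fin l) K) • d :=
    smul_right_injective _ hP hcr
  have hcc : (C c⁻¹ * C c : MvPolynomial (Fin l) K) = 1 := by
    rw [← C_mul, inv_mul_cancel₀ hc, C_1]
  refine ⟨fun k => C c⁻¹ * q k, fun j => ?_, fun k => ?_⟩
  · have h4 := congrFun hcr3 j
    simp only [Matrix.mulVec, dotProduct, Matrix.transpose_apply, Pi.smul_apply,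
      smul_eq_mul] at h4
    have : ∑ k, C c⁻¹ * q k * M k j = C c⁻¹ * ∑ k, M k j * q k := by
      rw [Finset.mul_sum]
      exact Finset.sum_congr rfl fun k _ => by ring
    rw [this, h4, ← mul_assoc, hcc, one_mul]
  · rw [hq, hdet]
    linear_combination (q k * ∏ i, linForm (a i)) * hcc

/-- The easy half of Saito's criterion. -/
theorem CentralArrangement.IsDefinedBy.isFreeWithExponents_of_det (h : A.IsDefinedBy a)
    {e : Fin l → ℕ} {M : Matrix (Fin l) (Fin l) (MvPolynomial (Fin l) K)}
    (hM : ∀ k, IsLogField a (M k)) (hhom : ∀ k j, (M k j).IsHomogeneous (e k)) {c : K}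
    (hc : c ≠ 0) (hdet : M.det = C c * ∏ i, linForm (a i)) : A.IsFreeWithExponents e := by
  have hdet0 := h.det_ne_zero hc hdet
  let v : Fin l → A.logVectorFields := fun k =>
    ⟨mkDerivation K (M k), by
      rw [h.mem_logVectorFields_iff]
      simpa only [mkDerivation_X] using hM k⟩
  have hsum : ∀ (g : Fin l → MvPolynomial (Fin l) K) (j : Fin l),
      ((∑ k, g k • v k : A.logVectorFields) :
        Derivation K (MvPolynomial (Fin l) K) (MvPolynomial (Fin l) K)) (X j) =
        ∑ k, g k * M k j := by
    intro g j
    simp only [Submodule.coe_sum, Submodule.coe_smul, Derivation.sum_smul_apply, v,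
      mkDerivation_X]
  have hli : LinearIndependent (MvPolynomial (Fin l) K) v := by
    rw [Fintype.linearIndependent_iffₛ]
    intro f g hfg k
    have : Matrix.vecMul (f - g) M = 0 := by
      rw [Matrix.sub_vecMul, sub_eq_zero]
      ext1 j
      simpa only [Matrix.vecMul, dotProduct, hfg, hsum] using (hsum f j).symm
    exact sub_eq_zero.mp (congrFun (Matrix.eq_zero_of_vecMul_eq_zero hdet0 this) k)
  have hspan : ⊤ ≤ Submodule.span (MvPolynomial (Fin l) K) (Set.range v) := by
    rintro ⟨δ, hδ'⟩ -
    have hδ := hδ'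
    rw [h.mem_logVectorFields_iff] at hδ
    obtain ⟨q, hq, -⟩ := h.exists_sum_mul_eq hM hc hdet hδ
    have : (⟨δ, hδ'⟩ : A.logVectorFields) = ∑ k, q k • v k := by
      apply Subtype.ext
      apply MvPolynomial.derivation_ext
      intro j
      rw [hsum, hq]
    rw [this]
    exact Submodule.sum_mem _ fun k _ =>
      Submodule.smul_mem _ _ (Submodule.subset_span ⟨k, rfl⟩)
  refine ⟨Module.Basis.mk hli hspan, fun k j => ?_⟩
  rw [Module.Basis.mk_apply]
  simpa [v, mkDerivation_X] using hhom k j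

/-- For each hyperplane `i₀` there are `l` vector fields in `D(A)` whose coefficient determinant
is the product of all linear forms, times a power of the product of the forms other than `i₀`. -/
theorem CentralArrangement.IsDefinedBy.exists_isLogField_det [DecidableEq ι]
    (h : A.IsDefinedBy a) (i₀ : ι) :
    ∃ N : Matrix (Fin l) (Fin l) (MvPolynomial (Fin l) K), (∀ k, IsLogField a (N k)) ∧
      ∃ n : ℕ, N.det = (∏ i, linForm (a i)) * (∏ i ∈ Finset.univ.erase i₀, linForm (a i)) ^ n := by
  obtain ⟨j₀, hj₀⟩ := Function.ne_iff.mp (h.ne_zero i₀)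
  set R := ∏ i ∈ Finset.univ.erase i₀, linForm (a i)
  set Q := ∏ i, linForm (a i)
  have hRd : ∀ i, i ≠ i₀ → linForm (a i) ∣ R := fun i hi =>
    Finset.dvd_prod_of_mem _ (by simp [hi])
  have hQd : ∀ i, linForm (a i) ∣ Q := fun i => Finset.dvd_prod_of_mem _ (by simp)
  -- The fields `Q ∂_{j₀}` and, for `k ≠ j₀`, the fields `R (∂_k - (a_k / a_{j₀}) ∂_{j₀})`,
  -- which kill the form of the hyperplane `i₀`.
  let b : Fin l → MvPolynomial (Fin l) K := fun k => C ((a i₀ j₀)⁻¹ * a i₀ k)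
  let N : Matrix (Fin l) (Fin l) (MvPolynomial (Fin l) K) := fun k =>
    if k = j₀ then Pi.single j₀ Q else Pi.single k R - Pi.single j₀ (R * b k)
  have happ : ∀ (c : Fin l → K) (k : Fin l) (r : MvPolynomial (Fin l) K),
      applyField c (Pi.single k r) = C (c k) * r := by
    intro c k r
    rw [applyField, Finset.sum_eq_single k]
    · simp
    · intro j _ hj
      simp [Pi.single_eq_of_ne hj]
    · simp
  have hsub : ∀ (c : Fin l → K) (f g : Fin l → MvPolynomial (Fin l) K),
      applyField c (f - g) = applyField c f - applyField c g := by
    intro c f g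
    simp [applyField, mul_sub]
  have hkill : ∀ k, C (a i₀ k) * R - C (a i₀ j₀) * (R * b k) = 0 := by
    intro k
    have : (C (a i₀ j₀) * b k : MvPolynomial (Fin l) K) = C (a i₀ k) := by
      rw [← C_mul, mul_inv_cancel_left₀ hj₀]
    linear_combination (-R) * this
  refine ⟨N, ?_, (Finset.univ.erase j₀).card, ?_⟩
  · intro k i
    by_cases hk : k = j₀
    · simp only [N, hk, if_true, happ]
      exact (hQd i).mul_left _
    · simp only [N, hk, if_false, hsub, happ]
      by_cases hi : i = i₀
      · rw [hi, hkill]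
        exact dvd_zero _
      · exact dvd_sub ((hRd i hi).mul_left _) (((hRd i hi).mul_right _).mul_left _)
  · have hbj : b j₀ = 1 := by simp only [b, inv_mul_cancel₀ hj₀, C_1]
    have h1 := Matrix.det_updateCol_sum N j₀ b
    have hD : (N.updateCol j₀ fun k => ∑ i, b i • N k i) =
        Matrix.diagonal fun k => if k = j₀ then Q else R := by
      have hs : ∀ (k : Fin l) (r : MvPolynomial (Fin l) K),
          ∑ i, b i * (Pi.single k r : Fin l → MvPolynomial (Fin l) K) i = b k * r := by
        intro k r
        rw [Finset.sum_eq_single k]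
        · simp
        · intro j _ hj
          simp [Pi.single_eq_of_ne hj]
        · simp
      ext1 k j
      by_cases hj : j = j₀
      · subst hj
        rw [Matrix.updateCol_self]
        by_cases hk : k = j
        · subst hk
          simp [N, hs, hbj]
        · simp only [N, hk, if_false, smul_eq_mul, Pi.sub_apply, mul_sub,
            Finset.sum_sub_distrib, hs, hbj]
          rw [Matrix.diagonal_apply_ne _ hk]
          ring
      · rw [Matrix.updateCol_ne hj]
        by_cases hk : k = j₀
        · subst hk
          rw [Matrix.diagonal_apply_ne' _ hj]
          simp [N, Pi.single_eq_of_ne hj]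
        · by_cases hkj : j = k
          · subst hkj
            simp [N, hk]
          · rw [Matrix.diagonal_apply_ne' _ hkj]
            simp [N, hk, Pi.single_eq_of_ne hj, Pi.single_eq_of_ne hkj]
    rw [hD, Matrix.det_diagonal, hbj] at h1
    rw [one_smul] at h1
    rw [← h1, ← Finset.mul_prod_erase _ _ (Finset.mem_univ j₀), if_pos rfl,
      Finset.prod_congr rfl fun k hk => if_neg (Finset.ne_of_mem_erase hk), Finset.prod_const]

/-- Saito's criterion: `A` is free with exponents `e` if and only if `D(A)` contains `l`
homogeneous vector fields of degrees `e` whose coefficient determinant is a nonzero scalar multiple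
of the product of the linear forms. -/
theorem CentralArrangement.IsDefinedBy.isFreeWithExponents_iff (h : A.IsDefinedBy a)
    (e : Fin l → ℕ) : A.IsFreeWithExponents e ↔
      ∃ M : Matrix (Fin l) (Fin l) (MvPolynomial (Fin l) K), (∀ k, IsLogField a (M k)) ∧
        (∀ k j, (M k j).IsHomogeneous (e k)) ∧
        ∃ c : K, c ≠ 0 ∧ M.det = C c * ∏ i, linForm (a i) := by
  classical
  refine ⟨?_, fun ⟨M, hM, hhom, c, hc, hdet⟩ => h.isFreeWithExponents_of_det hM hhom hc hdet⟩
  rintro ⟨δ, hδ⟩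
  let M : Matrix (Fin l) (Fin l) (MvPolynomial (Fin l) K) := fun k j =>
    (δ k : Derivation K (MvPolynomial (Fin l) K) (MvPolynomial (Fin l) K)) (X j)
  have hM : ∀ k, IsLogField a (M k) := fun k => (h.mem_logVectorFields_iff _).mp (δ k).2
  refine ⟨M, hM, hδ, ?_⟩
  have hP := prod_linForm_ne_zero h
  obtain ⟨f, hf⟩ := prod_linForm_dvd_det h M hM
  -- The coefficient matrix of any `l` elements of `D(A)` is a left multiple of that of the basis.
  have hdvd : ∀ N : Matrix (Fin l) (Fin l) (MvPolynomial (Fin l) K),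
      (∀ k, IsLogField a (N k)) → M.det ∣ N.det := by
    intro N hN
    have hN' : ∀ k, mkDerivation K (N k) ∈ A.logVectorFields := by
      intro k
      rw [h.mem_logVectorFields_iff]
      simpa only [mkDerivation_X] using hN k
    have : N = (Matrix.of fun k k' => δ.repr ⟨_, hN' k⟩ k') * M := by
      ext1 k j
      have h1 := congrArg (fun x : A.logVectorFields =>
        (x : Derivation K (MvPolynomial (Fin l) K) (MvPolynomial (Fin l) K)) (X j))
        (δ.sum_repr ⟨_, hN' k⟩)
      simp only [mkDerivation_X] at h1
      rw [← h1, Matrix.mul_apply]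
      simp only [Submodule.coe_sum, Submodule.coe_smul, Derivation.sum_smul_apply,
        Matrix.of_apply, M]
    rw [this, Matrix.det_mul]
    exact Dvd.intro_left _ rfl
  have hfd : ∀ i₀, ∃ n : ℕ, f ∣ (∏ i ∈ Finset.univ.erase i₀, linForm (a i)) ^ n := by
    intro i₀
    obtain ⟨N, hN, n, hdet⟩ := h.exists_isLogField_det i₀
    refine ⟨n, ?_⟩
    have h2 := hdvd N hN
    rw [hdet, hf] at h2
    exact (mul_dvd_mul_iff_left hP).mp h2
  have hunit : IsUnit f := by
    rcases isEmpty_or_nonempty ι with hι | ⟨⟨i₁⟩⟩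
    · have h2 := hdvd 1 fun k i => hι.elim i
      rw [hf, Matrix.det_one, Finset.univ_eq_empty, Finset.prod_empty, one_mul] at h2
      exact isUnit_of_dvd_one h2
    · by_contra hu
      have hf0 : f ≠ 0 := by
        obtain ⟨n, hn⟩ := hfd i₁
        rintro rfl
        exact pow_ne_zero n (Finset.prod_ne_zero_iff.mpr fun i _ =>
          linForm_ne_zero (h.ne_zero i)) (zero_dvd_iff.mp hn)
      obtain ⟨π, hπ, hπf⟩ := WfDvdMonoid.exists_irreducible_factor hu hf0
      have key : ∀ i₀, ∃ i, i ≠ i₀ ∧ π ∣ linForm (a i) := by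
        intro i₀
        obtain ⟨n, hn⟩ := hfd i₀
        obtain ⟨i, hi, hd⟩ := (hπ.prime.dvd_finsetProd_iff _).mp
          (hπ.prime.dvd_of_dvd_pow (hπf.trans hn))
        exact ⟨i, Finset.ne_of_mem_erase hi, hd⟩
      obtain ⟨i₂, -, h2⟩ := key i₁
      obtain ⟨i₃, h32, h3⟩ := key i₂
      exact hπ.not_isUnit (h.isRelPrime h32 h3 h2)
  obtain ⟨c, hc, rfl⟩ := MvPolynomial.isUnit_iff_eq_C_of_isReduced.mp hunit
  exact ⟨c, hc.ne_zero, by rw [hf, mul_comm]⟩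

theorem isHomogeneous_det {R : Type*} [CommRing R] {l : ℕ} {e : Fin l → ℕ}
    {M : Matrix (Fin l) (Fin l) (MvPolynomial (Fin l) R)}
    (hhom : ∀ k j, (M k j).IsHomogeneous (e k)) : M.det.IsHomogeneous (∑ k, e k) := by
  rw [← Matrix.det_transpose, Matrix.det_apply]
  refine IsHomogeneous.sum _ _ _ fun σ _ => ?_
  rw [Units.smul_def, ← mem_homogeneousSubmodule]
  exact zsmul_mem ((mem_homogeneousSubmodule _ _).mpr
    (IsHomogeneous.prod _ _ _ fun i _ => hhom i (σ i))) _

/-- The exponents of a free arrangement add up to the number of hyperplanes. -/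
theorem sum_exponents_eq (h : A.IsDefinedBy a) {e : Fin l → ℕ}
    {M : Matrix (Fin l) (Fin l) (MvPolynomial (Fin l) K)}
    (hhom : ∀ k j, (M k j).IsHomogeneous (e k)) {c : K}
    (hc : c ≠ 0) (hdet : M.det = C c * ∏ i, linForm (a i)) : ∑ k, e k = Fintype.card ι := by
  have h1 : (C c * ∏ i, linForm (a i)).IsHomogeneous (∑ _ : ι, 1) :=
    (IsHomogeneous.prod _ _ _ fun i _ => isHomogeneous_linForm (a i)).C_mul c
  have h2 : M.det.IsHomogeneous (∑ k, e k) := isHomogeneous_det hhom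
  have h0 := h.det_ne_zero hc hdet
  rw [← hdet] at h1
  simpa using h2.inj_right h1 h0

end SaitoCriterion

/-! ### The lattice of intersections -/

section Lattice

variable {K : Type*} [Field K] {l : ℕ}

namespace CentralArrangement

theorem top_mem_flats (A : CentralArrangement K l) : ⊤ ∈ A.flats :=
  ⟨∅, Finset.empty_subset _, by simp⟩

theorem inf_mem_flats {A : CentralArrangement K l} {X H : Submodule K (Fin l → K)}
    (hX : X ∈ A.flats) (hH : H ∈ A.hyperplanes) : X ⊓ H ∈ A.flats := by
  classical
  obtain ⟨B, hB, rfl⟩ := hX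
  refine ⟨insert H B, Finset.insert_subset hH hB, ?_⟩
  rw [Finset.iInf_insert, inf_comm]

theorem finite_flats (A : CentralArrangement K l) : A.flats.Finite := by
  classical
  refine (A.hyperplanes.powerset.image fun B => ⨅ H ∈ B, H).finite_toSet.subset ?_
  rintro X ⟨B, hB, rfl⟩
  simp only [Finset.coe_image, Set.mem_image, Finset.mem_coe, Finset.mem_powerset]
  exact ⟨B, hB, rfl⟩

instance (A : CentralArrangement K l) : Finite A.flats := A.finite_flats

instance (A : CentralArrangement K l) : OrderTop A.flats where
  top := ⟨⊤, A.top_mem_flats⟩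
  le_top _ := le_top (α := Submodule K (Fin l → K))

theorem coe_top_flats (A : CentralArrangement K l) :
    ((⊤ : A.flats) : Submodule K (Fin l → K)) = ⊤ := rfl

end CentralArrangement

theorem finrank_inf_ker_add_one (Y : Submodule K (Fin l → K)) (f : Module.Dual K (Fin l → K))
    (h : ¬ Y ≤ LinearMap.ker f) :
    Module.finrank K ↥(Y ⊓ LinearMap.ker f) + 1 = Module.finrank K Y := by
  have hg : f.domRestrict Y ≠ 0 := by
    intro h0
    exact h fun y hy => LinearMap.congr_fun h0 ⟨y, hy⟩
  rw [← LinearMap.finrank_range_add_finrank_ker (f.domRestrict Y),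
    LinearMap.range_eq_top.mpr (LinearMap.surjective_of_ne_zero hg), finrank_top,
    Module.finrank_self, add_comm, ← Submodule.map_comap_subtype, Submodule.finrank_map_subtype_eq]
  rfl

/-- The lattice of intersections is graded by codimension. -/
theorem CentralArrangement.finrank_add_one_of_covBy {A : CentralArrangement K l} {X Y : A.flats}
    (h : X ⋖ Y) : Module.finrank K (X : Submodule K (Fin l → K)) + 1 =
      Module.finrank K (Y : Submodule K (Fin l → K)) := by
  obtain ⟨B, hB, hX⟩ := X.2
  have hYX : ¬ (Y : Submodule K (Fin l → K)) ≤ X := h.lt.not_ge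
  rw [hX] at hYX
  simp only [le_iInf_iff, not_forall] at hYX
  obtain ⟨H, hH, hYH⟩ := hYX
  have hXH : (X : Submodule K (Fin l → K)) ≤ H := hX.le.trans (iInf₂_le H hH)
  let Z : A.flats := ⟨Y ⊓ H, inf_mem_flats Y.2 (hB hH)⟩
  have hXZ : X ≤ Z := le_inf (α := Submodule K (Fin l → K)) h.le hXH
  have hZY : Z < Y := lt_of_le_of_ne (inf_le_left (α := Submodule K (Fin l → K))) fun heq =>
    hYH ((congrArg Subtype.val heq).symm.le.trans inf_le_right)
  have hXeq : X = Z := by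
    by_contra hne
    exact h.2 (lt_of_le_of_ne hXZ hne) hZY
  obtain ⟨a, ha⟩ := exists_linearLocus_eq (A.isCoatom_of_mem H (hB hH))
  rw [linearLocus_eq_ker] at ha
  rw [hXeq]
  subst ha
  exact finrank_inf_ker_add_one _ _ hYH

theorem CentralArrangement.finrank_orderIso {A B : CentralArrangement K l}
    (φ : A.flats ≃o B.flats)
    (X : A.flats) : Module.finrank K (φ X : Submodule K (Fin l → K)) =
      Module.finrank K (X : Submodule K (Fin l → K)) := by
  induction X using WellFoundedGT.induction with
  | ind X ih =>
    by_cases hX : IsMax X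
    · rw [hX.eq_top, map_top, coe_top_flats, coe_top_flats]
    · obtain ⟨Y, hXY⟩ := exists_covBy_of_wellFoundedLT hX
      have h1 := finrank_add_one_of_covBy hXY
      have h2 := finrank_add_one_of_covBy ((apply_covBy_apply_iff φ).mpr hXY)
      have h3 := ih Y hXY.lt
      lia

open Classical in
/-- The smallest element of the lattice of intersections that contains `v`. -/
noncomputable def CentralArrangement.flatOf (A : CentralArrangement K l) (v : Fin l → K) :
    A.flats :=
  ⟨⨅ H ∈ A.hyperplanes.filter (v ∈ ·), H, _, Finset.filter_subset _ _, rfl⟩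

theorem CentralArrangement.flatOf_le_iff {A : CentralArrangement K l} {v : Fin l → K}
    {X : A.flats} : A.flatOf v ≤ X ↔ v ∈ (X : Submodule K (Fin l → K)) := by
  constructor
  · intro h
    apply h
    simp [flatOf, Submodule.mem_iInf]
  · intro h
    obtain ⟨_, B, hB, rfl⟩ := X
    simp only [Submodule.mem_iInf] at h
    refine le_iInf₂ (α := Submodule K (Fin l → K)) fun H hH =>
      iInf₂_le (α := Submodule K (Fin l → K)) H ?_
    simp [hB hH, h H hH]

open Classical in
theorem CentralArrangement.flatOf_eq_top_iff {A : CentralArrangement K l} {v : Fin l → K} :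
    A.flatOf v = ⊤ ↔ ∀ H ∈ A.hyperplanes, v ∉ H := by
  constructor
  · intro h H hH hv
    have h1 : A.flatOf v ≤ ⟨⊤ ⊓ H, inf_mem_flats A.top_mem_flats hH⟩ := by
      rw [flatOf_le_iff]
      simpa using hv
    rw [h, top_le_iff] at h1
    have h2 := congrArg Subtype.val h1
    exact (A.isCoatom_of_mem H hH).1 (by simpa [coe_top_flats] using h2)
  · intro h
    rw [← top_le_iff]
    refine le_iInf₂ (α := Submodule K (Fin l → K)) fun H hH => ?_
    rw [Finset.mem_filter] at hH
    exact absurd hH.2 (h H hH.1)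

open Classical in
/-- Over a finite field the number of points whose smallest flat is a given one is determined by
the lattice of intersections: it is computed by Möbius inversion from the dimensions of the
flats. -/
theorem CentralArrangement.card_flatOf_eq [Fintype K] {A B : CentralArrangement K l}
    (φ : A.flats ≃o B.flats) (X : A.flats) :
    (Finset.univ.filter fun v => B.flatOf v = φ X).card =
      (Finset.univ.filter fun v => A.flatOf v = X).card := by
  have : Fintype A.flats := Fintype.ofFinite _
  have : Fintype B.flats := Fintype.ofFinite _
  have key : ∀ (C : CentralArrangement K l) [Fintype C.flats] (Y : C.flats),
      (Finset.univ.filter fun v => C.flatOf v = Y).card +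
        ∑ Z ∈ Finset.univ.filter (· < Y), (Finset.univ.filter fun v => C.flatOf v = Z).card =
        Fintype.card K ^ Module.finrank K (Y : Submodule K (Fin l → K)) := by
    intro C _ Y
    rw [← Module.card_eq_pow_finrank, Fintype.card_subtype,
      Finset.card_eq_sum_card_fiberwise (f := C.flatOf)
        (s := Finset.univ.filter (· ∈ (Y : Submodule K (Fin l → K))))
        (t := Finset.univ.filter (· ≤ Y))]
    · have hset : Finset.univ.filter (· ≤ Y) = insert Y (Finset.univ.filter (· < Y)) := by
        ext Z
        simp [le_iff_eq_or_lt]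
      rw [hset, Finset.sum_insert (by simp)]
      have hf : ∀ Z ≤ Y, (Finset.univ.filter fun v => C.flatOf v = Z) =
          (Finset.univ.filter (· ∈ (Y : Submodule K (Fin l → K)))).filter
            fun v => C.flatOf v = Z := by
        intro Z hZ
        rw [Finset.filter_filter]
        refine Finset.filter_congr fun v _ => ⟨fun h => ⟨?_, h⟩, fun h => h.2⟩
        rw [← flatOf_le_iff, h]
        exact hZ
      congr 1
      · exact congrArg _ (hf Y le_rfl)
      · exact Finset.sum_congr rfl fun Z hZ =>
          congrArg _ (hf Z (Finset.mem_filter.mp hZ).2.le)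
    · intro v hv
      simpa [flatOf_le_iff] using hv
  induction X using WellFoundedLT.induction with
  | ind X ih =>
    have h1 := key A X
    have h2 := key B (φ X)
    rw [finrank_orderIso, ← h1] at h2
    have h3 : ∑ Z ∈ Finset.univ.filter (· < φ X),
        (Finset.univ.filter fun v => B.flatOf v = Z).card =
        ∑ Z ∈ Finset.univ.filter (· < X), (Finset.univ.filter fun v => A.flatOf v = Z).card := by
      symm
      refine Finset.sum_bij (fun Z _ => φ Z) ?_ ?_ ?_ ?_
      · intro Z hZ
        simpa using hZ
      · intro Z _ Z' _ h
        exact φ.injective h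
      · intro Z hZ
        exact ⟨φ.symm Z, by simpa [OrderIso.symm_apply_lt] using hZ, by simp⟩
      · intro Z hZ
        exact (ih Z (Finset.mem_filter.mp hZ).2).symm
    lia

open Classical in
/-- Over a finite field the number of points off all hyperplanes is determined by the lattice of
intersections. -/
theorem CentralArrangement.card_complement_eq [Fintype K] {A B : CentralArrangement K l}
    (h : Nonempty (A.IntersectionLattice ≃o B.IntersectionLattice)) :
    (Finset.univ.filter fun v => ∀ H ∈ B.hyperplanes, v ∉ H).card =
      (Finset.univ.filter fun v => ∀ H ∈ A.hyperplanes, v ∉ H).card := by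
  obtain ⟨φ⟩ := h
  let ψ : A.flats ≃o B.flats := φ.dual
  have := card_flatOf_eq ψ ⊤
  rw [map_top] at this
  simpa only [flatOf_eq_top_iff] using this

theorem CentralArrangement.IsDefinedBy.iInf_mem_flats {ι : Type*} [Finite ι]
    {A : CentralArrangement K l} {a : ι → Fin l → K} (h : A.IsDefinedBy a) (s : Set ι) :
    ⨅ i : s, linearLocus (a i) ∈ A.flats := by
  classical
  have := Fintype.ofFinite s
  refine ⟨Finset.univ.image fun i : s => linearLocus (a i), ?_, ?_⟩
  · intro H hH
    obtain ⟨i, -, rfl⟩ := Finset.mem_image.mp hH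
    exact (h.mem_iff _).mpr ⟨i, rfl⟩
  · rw [Finset.iInf_finset_image]
    simp

theorem CentralArrangement.IsDefinedBy.exists_iInf_eq {ι : Type*}
    {A : CentralArrangement K l} {a : ι → Fin l → K} (h : A.IsDefinedBy a) (X : A.flats) :
    ∃ s : Set ι, ⨅ i : s, linearLocus (a i) = (X : Submodule K (Fin l → K)) := by
  obtain ⟨B, hB, hX⟩ := X.2
  refine ⟨{i | linearLocus (a i) ∈ B}, ?_⟩
  rw [hX]
  apply le_antisymm
  · refine le_iInf₂ fun H hH => ?_
    obtain ⟨i, hi⟩ := (h.mem_iff H).mp (hB hH)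
    have hi' : i ∈ {i | linearLocus (a i) ∈ B} := by
      rw [Set.mem_ofPred_eq, hi]
      exact hH
    exact (iInf_le (fun j : {i | linearLocus (a i) ∈ B} => linearLocus (a j)) ⟨i, hi'⟩).trans hi.le
  · exact le_iInf fun i => iInf₂_le (linearLocus (a i)) i.2

/-- The lattice of intersections is determined by the linear dependencies among the defining
forms: it suffices to know which forms lie in the spans of which others. The two arrangements may
live over different fields. -/
theorem CentralArrangement.IsDefinedBy.nonempty_orderIso {K' : Type*} [Field K'] {l' : ℕ}
    {ι : Type*} [Finite ι] {A : CentralArrangement K l} {A' : CentralArrangement K' l'}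
    {a : ι → Fin l → K} {a' : ι → Fin l' → K'} (h : A.IsDefinedBy a) (h' : A'.IsDefinedBy a')
    (hspan : ∀ (s : Set ι) (j : ι), a j ∈ Submodule.span K (Set.range fun i : s => a i) ↔
      a' j ∈ Submodule.span K' (Set.range fun i : s => a' i)) :
    Nonempty (A.IntersectionLattice ≃o A'.IntersectionLattice) := by
  choose s hs using h.exists_iInf_eq
  choose s' hs' using h'.exists_iInf_eq
  have hle : ∀ t u : Set ι, ⨅ i : t, linearLocus (a' i) ≤ ⨅ i : u, linearLocus (a' i) ↔
      ⨅ i : t, linearLocus (a i) ≤ ⨅ i : u, linearLocus (a i) := by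
    intro t u
    simp only [le_iInf_iff, iInf_linearLocus_le_iff, hspan]
  let f : A.flats ↪o A'.flats := OrderEmbedding.ofMapLEIff
    (fun X => ⟨⨅ i : s X, linearLocus (a' i), h'.iInf_mem_flats _⟩) fun X Y => by
      refine (hle (s X) (s Y)).trans ?_
      rw [hs, hs]
      rfl
  have hf : Function.Surjective f := by
    intro Y
    refine ⟨⟨⨅ i : s' Y, linearLocus (a i), h.iInf_mem_flats _⟩, Subtype.ext ?_⟩
    change ⨅ i : s _, linearLocus (a' i) = _
    rw [← hs']
    apply le_antisymm
    · rw [hle, hs]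
    · rw [hle, hs]
  let φ : A.flats ≃o A'.flats := RelIso.ofSurjective f hf
  exact ⟨φ.dual⟩

end Lattice

/-! ### Leading terms at a simple zero -/

section LeadingTerms

variable {R : Type*} [CommRing R] {σ : Type*}

theorem mem_pow_idealOfVars_of_algHom (φ : MvPolynomial σ R →ₐ[R] MvPolynomial σ R)
    (hφ : ∀ i, φ (X i) ∈ idealOfVars σ R) {n : ℕ} {f : MvPolynomial σ R}
    (hf : f ∈ idealOfVars σ R ^ n) : φ f ∈ idealOfVars σ R ^ n := by
  have h1 : (idealOfVars σ R).map φ ≤ idealOfVars σ R := by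
    rw [Ideal.map_span, Ideal.span_le]
    rintro _ ⟨_, ⟨i, rfl⟩, rfl⟩
    exact hφ i
  have h2 := Ideal.mem_map_of_mem φ hf
  rw [Ideal.map_pow] at h2
  exact Ideal.pow_right_mono h1 n h2

theorem X_mem_idealOfVars (i : σ) : (X i : MvPolynomial σ R) ∈ idealOfVars σ R :=
  Ideal.subset_span ⟨i, rfl⟩

/-- An endomorphism which is the identity to first order preserves leading forms. -/
theorem algHom_sub_self_mem_pow (χ : MvPolynomial σ R →ₐ[R] MvPolynomial σ R)
    (hχ : ∀ i, χ (X i) - X i ∈ idealOfVars σ R ^ 2) {n : ℕ} {f : MvPolynomial σ R}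
    (hf : f ∈ idealOfVars σ R ^ n) : χ f - f ∈ idealOfVars σ R ^ (n + 1) := by
  have hχ1 : ∀ i, χ (X i) ∈ idealOfVars σ R := by
    intro i
    have := (idealOfVars σ R).add_mem (Ideal.pow_le_self two_ne_zero (hχ i)) (X_mem_idealOfVars i)
    simpa using this
  have hC : ∀ g, χ g - g ∈ idealOfVars σ R := by
    intro g
    induction g using MvPolynomial.induction_on with
    | C r => simp [← MvPolynomial.algebraMap_eq]
    | add p q hp hq =>
      rw [map_add, add_sub_add_comm]
      exact add_mem hp hq
    | mul_X p i hp =>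
      rw [map_mul]
      exact sub_mem (Ideal.mul_mem_left _ _ (hχ1 i))
        (Ideal.mul_mem_left _ _ (X_mem_idealOfVars i))
  induction n generalizing f with
  | zero => simpa using hC f
  | succ n ih =>
    rw [pow_succ] at hf
    refine Submodule.mul_induction_on hf (fun g hg x hx => ?_) (fun g h hg hh => ?_)
    · refine Submodule.span_induction (p := fun x _ =>
        χ (g * x) - g * x ∈ idealOfVars σ R ^ (n + 1 + 1)) ?_ ?_ ?_ ?_ hx
      · rintro _ ⟨i, rfl⟩
        have h1 : (χ g - g) * χ (X i) ∈ idealOfVars σ R ^ (n + 1 + 1) := by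
          rw [pow_succ _ (n + 1)]
          exact Ideal.mul_mem_mul (ih hg) (hχ1 i)
        have h2 : g * (χ (X i) - X i) ∈ idealOfVars σ R ^ (n + 1 + 1) := by
          rw [add_assoc, pow_add]
          exact Ideal.mul_mem_mul hg (hχ i)
        convert add_mem h1 h2 using 1
        rw [map_mul]
        ring
      · simp
      · intro x y _ _ h1 h2
        rw [mul_add, map_add, add_sub_add_comm]
        exact add_mem h1 h2
      · intro r x hx h1
        have hgx : g * x ∈ idealOfVars σ R ^ (n + 1) := by
          rw [pow_succ]
          exact Ideal.mul_mem_mul hg hx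
        have h2 : (χ r - r) * χ (g * x) ∈ idealOfVars σ R ^ (n + 1 + 1) := by
          rw [pow_succ' _ (n + 1)]
          exact Ideal.mul_mem_mul (hC r) (mem_pow_idealOfVars_of_algHom χ hχ1 hgx)
        convert add_mem h2 (Ideal.mul_mem_left _ r h1) using 1
        simp only [map_mul, smul_eq_mul]
        ring
    · rw [map_add, add_sub_add_comm]
      exact add_mem hg hh

/-- If the linear parts of the polynomials `G` span the linear forms, substituting `G` into a
polynomial does not raise its order at the origin. -/
theorem mem_pow_of_aeval_mem_pow [Fintype σ] [DecidableEq σ] {G : σ → MvPolynomial σ R}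
    {B : Matrix σ σ R}
    (hB : ∀ i, X i - ∑ j, C (B i j) * G j ∈ idealOfVars σ R ^ 2) {n : ℕ} {P : MvPolynomial σ R}
    (hP : P ∈ idealOfVars σ R ^ n) (hPG : aeval G P ∈ idealOfVars σ R ^ (n + 1)) :
    P ∈ idealOfVars σ R ^ (n + 1) := by
  let Λ : Matrix σ σ R := Matrix.of fun j i => coeff (Finsupp.single i 1) (G j)
  have hBΛ : B * Λ = 1 := by
    ext i k
    have h := (mem_pow_idealOfVars_iff' 2 _).mp (hB i) (Finsupp.single k 1) (by simp)
    rw [coeff_sub, coeff_sum, sub_eq_zero] at h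
    simp only [coeff_C_mul, coeff_X, Finsupp.single_left_inj one_ne_zero] at h
    rw [Matrix.mul_apply, Matrix.one_apply, h]
    rfl
  have hΛB : Λ * B = 1 := mul_eq_one_comm.mp hBΛ
  let ψ : MvPolynomial σ R →ₐ[R] MvPolynomial σ R := aeval fun i => ∑ j, C (B i j) * X j
  let ψ' : MvPolynomial σ R →ₐ[R] MvPolynomial σ R := aeval fun j => ∑ i, C (Λ j i) * X i
  have hψ : ∀ i, ψ (X i) ∈ idealOfVars σ R := by
    intro i
    rw [aeval_X]
    exact sum_mem fun j _ => Ideal.mul_mem_left _ _ (X_mem_idealOfVars j)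
  have hψ' : ∀ i, ψ' (X i) ∈ idealOfVars σ R := by
    intro i
    rw [aeval_X]
    exact sum_mem fun j _ => Ideal.mul_mem_left _ _ (X_mem_idealOfVars j)
  have hψψ' : ψ (ψ' P) = P := by
    have : ψ.comp ψ' = AlgHom.id R _ := by
      apply MvPolynomial.algHom_ext
      intro j
      simp only [AlgHom.comp_apply, AlgHom.id_apply, ψ, ψ', aeval_X, map_sum, map_mul, algHom_C,
        MvPolynomial.algebraMap_eq, Finset.mul_sum]
      rw [Finset.sum_comm]
      have h2 : ∀ k, ∑ i, C (Λ j i) * (C (B i k) * X k : MvPolynomial σ R) =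
          C ((Λ * B) j k) * X k := by
        intro k
        rw [Matrix.mul_apply, map_sum, Finset.sum_mul]
        exact Finset.sum_congr rfl fun i _ => by rw [C_mul, mul_assoc]
      simp only [h2, hΛB, Matrix.one_apply]
      simp
    exact DFunLike.congr_fun this P
  have hf := mem_pow_idealOfVars_of_algHom ψ' hψ' hP
  have hχ := algHom_sub_self_mem_pow ((aeval G).comp ψ) (fun i => by
    have := neg_mem (hB i)
    rw [neg_sub] at this
    convert this using 2
    simp [ψ]) hf
  rw [AlgHom.comp_apply, hψψ'] at hχ
  have h3 := sub_mem hPG hχ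
  rw [sub_sub_cancel] at h3
  have h4 := mem_pow_idealOfVars_of_algHom ψ hψ h3
  rwa [hψψ'] at h4

theorem eq_zero_of_forall_mem_pow_idealOfVars {P : MvPolynomial σ R}
    (h : ∀ n, P ∈ idealOfVars σ R ^ n) : P = 0 := by
  ext d
  exact (mem_pow_idealOfVars_iff' _ P).mp (h (d.degree + 1)) d (Nat.lt_succ_self _)

theorem mem_idealOfVars_iff_constantCoeff {f : MvPolynomial σ R} :
    f ∈ idealOfVars σ R ↔ constantCoeff f = 0 := by
  rw [← pow_one (idealOfVars σ R), mem_pow_idealOfVars_iff', constantCoeff_eq]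
  refine ⟨fun h => h 0 (by simp), fun h x hx => ?_⟩
  have : x = 0 := (Finsupp.degree_eq_zero_iff x).mp (by lia)
  rw [this, h]

end LeadingTerms

/-! ### Counting monomials of bounded weight -/

section Counting

variable {σ : Type*}

/-- The monomials of weight at most `m`, where the `i`-th variable has weight `d i`. -/
def weightLE (d : σ → ℕ) (m : ℕ) : Set (σ →₀ ℕ) := {a | Finsupp.weight d a ≤ m}

theorem weightLE_finite [Finite σ] {d : σ → ℕ} (hd : ∀ i, 0 < d i) (m : ℕ) :
    (weightLE d m).Finite :=
  Finsupp.finite_of_nat_weight_le d (fun i => (hd i).ne') m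

theorem mem_weightLE [Fintype σ] {d : σ → ℕ} {m : ℕ} {a : σ →₀ ℕ} :
    a ∈ weightLE d m ↔ ∑ i, a i * d i ≤ m := by
  simp [weightLE, Finsupp.weight_eq_sum]

/-- Division with remainder by the weights compares the number of monomials of bounded weight with
the number of monomials of bounded degree. -/
theorem card_weightLE_one_le [Fintype σ] {d : σ → ℕ} (hd : ∀ i, 0 < d i) (m : ℕ) :
    Nat.card (weightLE (fun _ : σ => 1) m) ≤ (∏ i, d i) * Nat.card (weightLE d m) := by
  classical
  have := (weightLE_finite hd m).to_subtype
  have hcard : (∏ i, d i) * Nat.card (weightLE d m) =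
      Nat.card (((i : σ) → Fin (d i)) × weightLE d m) := by
    rw [Nat.card_prod, Nat.card_pi]
    simp
  rw [hcard]
  refine Nat.card_le_card_of_injective (fun a => (fun i => ⟨a.1 i % d i, Nat.mod_lt _ (hd i)⟩,
    ⟨Finsupp.equivFunOnFinite.symm fun i => a.1 i / d i, ?_⟩)) ?_
  · have ha := mem_weightLE.mp a.2
    rw [mem_weightLE]
    refine le_trans (Finset.sum_le_sum fun i _ => ?_) ha
    simpa using Nat.div_mul_le_self _ _
  · intro a b hab
    apply Subtype.ext
    ext i
    have h1 := congrArg Fin.val (congrFun (congrArg Prod.fst hab) i)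
    have h2 := DFunLike.congr_fun (congrArg Subtype.val (congrArg Prod.snd hab)) i
    simp only [Finsupp.equivFunOnFinite_symm_apply_apply] at h1 h2
    rw [← Nat.div_add_mod (a.1 i) (d i), h1, h2, Nat.div_add_mod]

theorem card_weightLE_le [Fintype σ] {d : σ → ℕ} (m : ℕ) :
    (∏ i, d i) * Nat.card (weightLE d m) ≤
      Nat.card (weightLE (fun _ : σ => 1) (m + ∑ i, d i)) := by
  classical
  have := (weightLE_finite (σ := σ) (d := fun _ => 1) (fun _ => one_pos)
    (m + ∑ i, d i)).to_subtype
  have hcard : (∏ i, d i) * Nat.card (weightLE d m) =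
      Nat.card (((i : σ) → Fin (d i)) × weightLE d m) := by
    rw [Nat.card_prod, Nat.card_pi]
    simp
  rw [hcard]
  refine Nat.card_le_card_of_injective
    (fun a => ⟨Finsupp.equivFunOnFinite.symm fun i => a.2.1 i * d i + a.1 i, ?_⟩) ?_
  · have ha := mem_weightLE.mp a.2.2
    rw [mem_weightLE]
    simp only [Finsupp.equivFunOnFinite_symm_apply_apply, mul_one, Finset.sum_add_distrib]
    exact add_le_add ha (Finset.sum_le_sum fun i _ => (a.1 i).2.le)
  · intro a b hab
    have h2 := fun i => DFunLike.congr_fun (congrArg Subtype.val hab) i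
    simp only [Finsupp.equivFunOnFinite_symm_apply_apply] at h2
    have hpos : ∀ i, 0 < d i := fun i => (Nat.zero_le _).trans_lt (a.1 i).2
    refine Prod.ext (funext fun i => Fin.ext ?_) (Subtype.ext (Finsupp.ext fun i => ?_))
    · have := congrArg (· % d i) (h2 i)
      simpa [Nat.mod_eq_of_lt] using this
    · have := congrArg (· / d i) (h2 i)
      simpa [Nat.add_div_of_dvd_right, hpos i, Nat.div_eq_of_lt] using this

theorem card_weightLE_one_le_pow [Fintype σ] (m : ℕ) :
    Nat.card (weightLE (fun _ : σ => 1) m) ≤ (m + 1) ^ Fintype.card σ := by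
  classical
  have hcard : (m + 1) ^ Fintype.card σ = Nat.card (σ → Fin (m + 1)) := by simp
  rw [hcard]
  refine Nat.card_le_card_of_injective (fun a i => ⟨a.1 i, ?_⟩) ?_
  · have ha := mem_weightLE.mp a.2
    simp only [mul_one] at ha
    exact Nat.lt_succ_of_le ((Finset.single_le_sum (fun j _ => Nat.zero_le (a.1 j))
      (Finset.mem_univ i)).trans ha)
  · intro a b hab
    apply Subtype.ext
    ext i
    exact congrArg Fin.val (congrFun hab i)

theorem card_weightLE_one_pos [Finite σ] (m : ℕ) :
    0 < Nat.card (weightLE (fun _ : σ => 1) m) := by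
  have := (weightLE_finite (σ := σ) (d := fun _ => 1) (fun _ => one_pos) m).to_subtype
  have : Nonempty (weightLE (fun _ : σ => 1) m) := ⟨⟨0, by simp [weightLE]⟩⟩
  exact Nat.card_pos

/-- A sequence of polynomial growth cannot grow geometrically along an arithmetic progression. -/
theorem le_of_mul_le_mul_shift {v : ℕ → ℕ} {k : ℕ} (hv : ∀ m, v m ≤ (m + 1) ^ k)
    (hpos : 0 < v 0) {N P D : ℕ} (h : ∀ m, N * v m ≤ P * v (m + D)) : N ≤ P := by
  by_contra! hlt
  have hP : 0 < P := by
    rcases Nat.eq_zero_or_pos P with h0 | h0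
    · have := h 0
      rw [h0, zero_mul] at this
      have := Nat.mul_pos (Nat.zero_lt_of_lt hlt) hpos
      lia
    · exact h0
  have hiter : ∀ n, N ^ n * v 0 ≤ P ^ n * v (n * D) := by
    intro n
    induction n with
    | zero => simp
    | succ n ih =>
      calc N ^ (n + 1) * v 0 = N * (N ^ n * v 0) := by ring
        _ ≤ N * (P ^ n * v (n * D)) := Nat.mul_le_mul_left _ ih
        _ = P ^ n * (N * v (n * D)) := by ring
        _ ≤ P ^ n * (P * v (n * D + D)) := Nat.mul_le_mul_left _ (h _)
        _ = P ^ (n + 1) * v ((n + 1) * D) := by rw [add_mul, one_mul]; ring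
  have hbound : ∀ n : ℕ, 1 ≤ n → (1 : ℝ) ≤ (D + 1 : ℝ) ^ k * ((n : ℝ) ^ k / ((N : ℝ) / P) ^ n) := by
    intro n hn
    have h1 : N ^ n ≤ P ^ n * (((D + 1) * n) ^ k) := by
      calc N ^ n ≤ N ^ n * v 0 := Nat.le_mul_of_pos_right _ hpos
        _ ≤ P ^ n * v (n * D) := hiter n
        _ ≤ P ^ n * (n * D + 1) ^ k := Nat.mul_le_mul_left _ (hv _)
        _ ≤ _ := by
          gcongr
          nlinarith
    have h2 : (N : ℝ) ^ n ≤ P ^ n * (((D + 1) * n) ^ k) := by exact_mod_cast h1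
    have hPr : (0 : ℝ) < P := by exact_mod_cast hP
    have hNr : (0 : ℝ) < N := hPr.trans (by exact_mod_cast hlt)
    rw [div_pow, div_div_eq_mul_div, ← mul_div_assoc, le_div_iff₀ (by positivity)]
    calc 1 * (N : ℝ) ^ n = (N : ℝ) ^ n := one_mul _
      _ ≤ P ^ n * (((D + 1) * n) ^ k) := h2
      _ = _ := by rw [mul_pow]; ring
  have hlim := (tendsto_pow_const_div_const_pow_of_one_lt k
    (r := (N : ℝ) / P) (by
      rw [one_lt_div (by exact_mod_cast hP)]
      exact_mod_cast hlt)).const_mul ((D + 1 : ℝ) ^ k)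
  rw [mul_zero] at hlim
  have := ge_of_tendsto hlim (Filter.eventually_atTop.mpr ⟨1, hbound⟩)
  linarith

end Counting

/-! ### Polynomial systems whose solutions are rational and simple -/

section WeightedDegree

variable {K : Type*} [Field K] {σ : Type*}

open scoped Pointwise in
theorem mul_mem_restrictSupport_weightLE {d : σ → ℕ} {m n : ℕ} {f g : MvPolynomial σ K}
    (hf : f ∈ restrictSupport K (weightLE d m)) (hg : g ∈ restrictSupport K (weightLE d n)) :
    f * g ∈ restrictSupport K (weightLE d (m + n)) := by
  have h := Submodule.mul_mem_mul hf hg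
  rw [← restrictSupport_add] at h
  refine restrictSupport_mono K ?_ h
  rintro _ ⟨a, ha, b, hb, rfl⟩
  simp only [weightLE, Set.mem_ofPred_eq, map_add] at ha hb ⊢
  lia

theorem weightLE_mono (d : σ → ℕ) {m n : ℕ} (h : m ≤ n) : weightLE d m ⊆ weightLE d n :=
  fun _ ha => le_trans ha h

theorem mem_restrictSupport_weightLE_one {m : ℕ} {f : MvPolynomial σ K} :
    f ∈ restrictSupport K (weightLE (fun _ => 1) m) ↔ f.totalDegree ≤ m := by
  rw [← mem_restrictTotalDegree, restrictTotalDegree]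
  simp only [weightLE, Finsupp.weight_apply, smul_eq_mul, mul_one]

theorem aeval_mem_of_weightLE [Fintype σ] {F : σ → MvPolynomial σ K} {d : σ → ℕ}
    (hF : ∀ j, (F j).totalDegree ≤ d j) {m : ℕ} {P : MvPolynomial σ K}
    (hP : P ∈ restrictSupport K (weightLE d m)) :
    aeval F P ∈ restrictSupport K (weightLE (fun _ : σ => 1) m) := by
  suffices h : restrictSupport K (weightLE d m) ≤
      (restrictSupport K (weightLE (fun _ : σ => 1) m)).comap (aeval F).toLinearMap from h hP
  rw [restrictSupport_eq_span, Submodule.span_le]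
  rintro _ ⟨a, ha, rfl⟩
  rw [mem_weightLE] at ha
  change aeval F (monomial a 1) ∈ restrictSupport K (weightLE (fun _ : σ => 1) m)
  rw [mem_restrictSupport_weightLE_one, aeval_monomial, map_one, one_mul,
    Finsupp.prod_fintype _ _ fun _ => pow_zero _]
  refine (totalDegree_finsetProd _ _).trans (le_trans (Finset.sum_le_sum fun j _ => ?_) ha)
  exact (totalDegree_pow _ _).trans (Nat.mul_le_mul_left _ (hF j))

theorem exists_mem_restrictSupport_weightLE {ι : Type*} [Finite ι] (d : σ → ℕ)
    (f : ι → MvPolynomial σ K) : ∃ m, ∀ i, f i ∈ restrictSupport K (weightLE d m) := by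
  classical
  have := Fintype.ofFinite ι
  refine ⟨∑ i, ∑ a ∈ (f i).support, Finsupp.weight d a, fun i => ?_⟩
  rw [mem_restrictSupport_iff]
  intro a ha
  exact (Finset.single_le_sum (f := fun a => Finsupp.weight d a) (fun _ _ => Nat.zero_le _)
    ha).trans (Finset.single_le_sum (f := fun i => ∑ a ∈ (f i).support, Finsupp.weight d a)
      (fun _ _ => Nat.zero_le _) (Finset.mem_univ i))

theorem finrank_restrictSupport (s : Set (σ →₀ ℕ)) :
    Module.finrank K (restrictSupport K s) = Nat.card s :=
  Module.finrank_eq_nat_card_basis (basisRestrictSupport K s)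

end WeightedDegree

section SimpleZeros

variable {p : ℕ} [Fact p.Prime] {σ : Type*} [Fintype σ]
  {F : σ → MvPolynomial σ (ZMod p)} {M : Matrix σ σ (MvPolynomial σ (ZMod p))} {d e : σ → ℕ}

open Classical in
/-- Replacing `X i ^ p` by `X i + ∑ j, F j * M j i`, where `M j i` has degree at most `p - d j`,
writes every polynomial of degree at most `m` as a combination of the monomials with all exponents
less than `p`, with coefficients polynomials in `F` of weight at most `m`. -/
theorem exists_eq_sum_aeval_mul_monomial (hM : ∀ j i, (M j i).totalDegree ≤ e j)
    (hd : ∀ j, 0 < d j) (hde : ∀ j, d j + e j ≤ p)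
    (hFM : ∀ i, ∑ j, F j * M j i = X i ^ p - X i) (m : ℕ) {f : MvPolynomial σ (ZMod p)}
    (hf : f ∈ restrictSupport (ZMod p) (weightLE (fun _ : σ => 1) m)) :
    ∃ P : (σ → Fin p) → MvPolynomial σ (ZMod p),
      (∀ β, P β ∈ restrictSupport (ZMod p) (weightLE d m)) ∧
      f = ∑ β, aeval F (P β) * ∏ i, X i ^ (β i : ℕ) := by
  let Φ : ((σ → Fin p) → MvPolynomial σ (ZMod p)) →ₗ[ZMod p] MvPolynomial σ (ZMod p) :=
    ∑ β, (LinearMap.mulRight (ZMod p) (∏ i, X i ^ (β i : ℕ))) ∘ₗ (aeval F).toLinearMap ∘ₗ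
      LinearMap.proj β
  have hΦ : ∀ P, Φ P = ∑ β, aeval F (P β) * ∏ i, X i ^ (β i : ℕ) := by
    intro P
    simp [Φ]
  let T : ℕ → Submodule (ZMod p) (MvPolynomial σ (ZMod p)) := fun m =>
    (Submodule.pi Set.univ fun _ => restrictSupport (ZMod p) (weightLE d m)).map Φ
  have hTmono : ∀ {m n : ℕ}, m ≤ n → T m ≤ T n := fun h =>
    Submodule.map_mono fun P hP β hβ => restrictSupport_mono _ (weightLE_mono d h) (hP β hβ)
  have hTF : ∀ {m n : ℕ} {j : σ} {g : MvPolynomial σ (ZMod p)}, g ∈ T m → m + d j ≤ n →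
      F j * g ∈ T n := by
    rintro m n j _ ⟨P, hP, rfl⟩ hmn
    refine ⟨fun β => X j * P β, fun β hβ => ?_, ?_⟩
    · refine restrictSupport_mono _ (weightLE_mono d hmn) ?_
      rw [add_comm]
      refine mul_mem_restrictSupport_weightLE ?_ (hP β hβ)
      rw [X, monomial_mem_restrictSupport]
      left
      simp [weightLE, Finsupp.weight_single]
    · simp only [hΦ, map_mul, aeval_X, Finset.mul_sum, mul_assoc]
  suffices h : ∀ m, restrictSupport (ZMod p) (weightLE (fun _ : σ => 1) m) ≤ T m by
    obtain ⟨P, hP, h⟩ := h m hf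
    exact ⟨P, fun β => hP β (Set.mem_univ β), h.symm.trans (hΦ P)⟩
  intro m
  induction m using Nat.strong_induction_on with
  | _ m ih =>
    rw [restrictSupport_eq_span, Submodule.span_le]
    rintro _ ⟨γ, hγ, rfl⟩
    change monomial γ 1 ∈ T m
    by_cases hlt : ∀ i, γ i < p
    · refine ⟨Pi.single (fun i => ⟨γ i, hlt i⟩) 1, fun β _ => ?_, ?_⟩
      · have h1 : (1 : MvPolynomial σ (ZMod p)) ∈ restrictSupport (ZMod p) (weightLE d m) := by
          rw [← C_1, C_apply, monomial_mem_restrictSupport]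
          left
          simp [weightLE]
        by_cases hβ : β = fun i => ⟨γ i, hlt i⟩
        · rw [hβ, Pi.single_eq_same]
          exact h1
        · rw [Pi.single_eq_of_ne hβ]
          exact zero_mem _
      · rw [hΦ, Finset.sum_eq_single (fun i => ⟨γ i, hlt i⟩)]
        · rw [Pi.single_eq_same, map_one, one_mul, monomial_eq, C_1, one_mul,
            Finsupp.prod_fintype _ _ fun _ => pow_zero _]
        · intro β _ hβ
          rw [Pi.single_eq_of_ne hβ, map_zero, zero_mul]
        · simp
    · push Not at hlt
      obtain ⟨i, hi⟩ := hlt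
      obtain ⟨γ', rfl⟩ : ∃ γ', γ = γ' + Finsupp.single i p :=
        ⟨γ - Finsupp.single i p, (tsub_add_cancel_of_le (by simpa using hi)).symm⟩
      have hdeg : Finsupp.weight (fun _ : σ => 1) γ' + p ≤ m := by
        simpa [weightLE, Finsupp.weight_single] using hγ
      have hp := (Fact.out : p.Prime).two_le
      have hX : (monomial (γ' + Finsupp.single i p) 1 : MvPolynomial σ (ZMod p)) =
          monomial (γ' + Finsupp.single i 1) 1 + ∑ j, F j * (monomial γ' 1 * M j i) := by
        have h1 : ∑ j, F j * (monomial γ' 1 * M j i) =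
            monomial γ' 1 * (X i ^ p - X i : MvPolynomial σ (ZMod p)) := by
          rw [← hFM, Finset.mul_sum]
          exact Finset.sum_congr rfl fun j _ => by ring
        rw [h1, monomial_add_single, monomial_add_single]
        ring
      rw [hX]
      refine add_mem ?_ (sum_mem fun j _ => ?_)
      · refine hTmono (Nat.sub_le m 1) (ih (m - 1) (by lia) ?_)
        rw [monomial_mem_restrictSupport]
        left
        simp only [weightLE, Set.mem_ofPred_eq, map_add, Finsupp.weight_single, smul_eq_mul]
        lia
      · have hdj := hde j
        have hdj' := hd j
        refine hTF (ih (m - d j) (by lia) ?_) (by lia : m - d j + d j ≤ m)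
        have h2 : (monomial γ' 1 : MvPolynomial σ (ZMod p)) ∈ restrictSupport (ZMod p)
            (weightLE (fun _ : σ => 1) (Finsupp.weight (fun _ : σ => 1) γ')) := by
          rw [monomial_mem_restrictSupport]
          exact Or.inl (le_refl (Finsupp.weight (fun _ : σ => 1) γ'))
        refine restrictSupport_mono _ (weightLE_mono _ ?_) (mul_mem_restrictSupport_weightLE h2
          (mem_restrictSupport_weightLE_one.mpr (hM j i)))
        lia

/-- A polynomial vanishing at all common zeros of the `F j` over `𝔽_p` is in the ideal they
generate, because this ideal contains all `X i ^ p - X i`. -/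
theorem mem_span_of_vanishes (hFM : ∀ i, ∑ j, F j * M j i = X i ^ p - X i)
    {f : MvPolynomial σ (ZMod p)}
    (hf : ∀ v : σ → ZMod p, (∀ j, eval v (F j) = 0) → eval v f = 0) :
    f ∈ Ideal.span (Set.range F) := by
  have hX : ∀ i, (X i ^ p - X i : MvPolynomial σ (ZMod p)) ∈ Ideal.span (Set.range F) := by
    intro i
    rw [← hFM i]
    exact sum_mem fun j _ => Ideal.mul_mem_right _ _ (Ideal.subset_span ⟨j, rfl⟩)
  have hall : ∀ g : MvPolynomial σ (ZMod p), (∀ v, eval v g = 0) →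
      g ∈ Ideal.span (Set.range F) := by
    intro g hg
    obtain ⟨h, -, hh⟩ := combinatorial_nullstellensatz_exists_linearCombination
      (fun _ : σ => (Finset.univ : Finset (ZMod p))) (fun _ => Finset.univ_nonempty) g
      fun x _ => hg x
    rw [hh, Finsupp.linearCombination_apply]
    refine sum_mem fun i _ => ?_
    refine Ideal.mul_mem_left _ _ ?_
    have h1 : (∏ r : ZMod p, (X i - C r) : MvPolynomial σ (ZMod p)) = X i ^ p - X i := by
      have h2 := Polynomial.prod_multiset_X_sub_C_of_monic_of_roots_card_eq
        (p := (Polynomial.X ^ p - Polynomial.X : Polynomial (ZMod p)))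
        (Polynomial.monic_X_pow_sub (by
          rw [Polynomial.degree_X]
          exact_mod_cast (Fact.out : p.Prime).one_lt)) (by
          have h3 := FiniteField.roots_X_pow_card_sub_X (ZMod p)
          rw [ZMod.card] at h3
          rw [h3, FiniteField.X_pow_card_sub_X_natDegree_eq _ (Fact.out : p.Prime).one_lt]
          simp)
      have h3 := FiniteField.roots_X_pow_card_sub_X (ZMod p)
      rw [ZMod.card] at h3
      rw [h3] at h2
      change ∏ r : ZMod p, (Polynomial.X - Polynomial.C r) = _ at h2
      have h4 := congrArg (Polynomial.aeval (X i : MvPolynomial σ (ZMod p))) h2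
      simpa only [map_prod, map_sub, map_pow, Polynomial.aeval_X, Polynomial.aeval_C,
        MvPolynomial.algebraMap_eq] using h4
    rw [h1]
    exact hX i
  classical
  -- Multiples of the `F j` are subtracted from `f` to make it vanish at the remaining points.
  have hj : ∀ v : σ → ZMod p, ∃ g ∈ Ideal.span (Set.range F),
      ∀ u, eval u g = if u = v then eval v f else 0 := by
    intro v
    by_cases hv : ∀ j, eval v (F j) = 0
    · exact ⟨0, zero_mem _, fun u => by simp [hf v hv]⟩
    · push Not at hv
      obtain ⟨j, hj⟩ := hv
      refine ⟨C (eval v f / eval v (F j)) * indicator v * F j,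
        Ideal.mul_mem_left _ _ (Ideal.subset_span ⟨j, rfl⟩), fun u => ?_⟩
      by_cases hu : u = v
      · subst hu
        simp [eval_indicator_apply_eq_one, hj]
      · simp [eval_indicator_apply_eq_zero _ _ hu, hu]
  choose g hg hgv using hj
  have h1 : f - ∑ v, g v ∈ Ideal.span (Set.range F) := by
    refine hall _ fun v => ?_
    rw [map_sub, map_sum]
    simp [hgv]
  simpa using add_mem h1 (sum_mem (t := Finset.univ) fun v _ => hg v)

open Classical in
/-- Interpolation polynomials of the common zeros of the `F j` are linearly independent over
`𝔽_p[F]`: at each zero the linear parts of the `F j` are independent, so the order of vanishing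
of `P(F)` there is the order of `P`. -/
theorem eq_zero_of_sum_aeval_mul_indicator (hFM : ∀ i, ∑ j, F j * M j i = X i ^ p - X i)
    {P : {v : σ → ZMod p // ∀ j, eval v (F j) = 0} → MvPolynomial σ (ZMod p)}
    (hP : ∑ v, aeval F (P v) * indicator v.1 = 0) (v) : P v = 0 := by
  suffices h : ∀ n v, P v ∈ idealOfVars σ (ZMod p) ^ n from
    eq_zero_of_forall_mem_pow_idealOfVars fun n => h n v
  intro n
  induction n with
  | zero => simp
  | succ n ih =>
    intro u
    let τ : MvPolynomial σ (ZMod p) →ₐ[ZMod p] MvPolynomial σ (ZMod p) :=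
      aeval fun i => X i + C (u.1 i)
    have hτ : ∀ f, constantCoeff (τ f) = eval u.1 f := by
      intro f
      induction f using MvPolynomial.induction_on with
      | C r => simp [τ, algHom_C, MvPolynomial.algebraMap_eq]
      | add f g hf hg => rw [map_add, map_add, map_add, hf, hg]
      | mul_X f i hf => rw [map_mul, map_mul, map_mul, hf]; simp [τ]
    let G : σ → MvPolynomial σ (ZMod p) := fun j => τ (F j)
    have hG : ∀ j, G j ∈ idealOfVars σ (ZMod p) := by
      intro j
      rw [mem_idealOfVars_iff_constantCoeff, hτ]
      exact u.2 j
    have hcomp : ∀ Q : MvPolynomial σ (ZMod p), τ (aeval F Q) = aeval G Q := by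
      intro Q
      have : τ.comp (aeval F) = aeval G := by
        apply MvPolynomial.algHom_ext
        intro j
        simp [G]
      exact DFunLike.congr_fun this Q
    have hGM : ∀ i, ∑ j, G j * τ (M j i) = X i ^ p - X i := by
      intro i
      have := congrArg τ (hFM i)
      simp only [map_sum, map_mul, map_sub, map_pow] at this
      rw [this, aeval_X, add_pow_char, ← C_pow, ZMod.pow_card]
      ring
    have hGn : ∀ v, aeval G (P v) ∈ idealOfVars σ (ZMod p) ^ n := fun v =>
      mem_pow_idealOfVars_of_algHom _ (fun i => by rw [aeval_X]; exact hG i) (ih v)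
    have hsum : ∑ v : {v : σ → ZMod p // ∀ j, eval v (F j) = 0},
        aeval G (P v) * τ (indicator v.1) = 0 := by
      have := congrArg τ hP
      rw [map_sum, map_zero] at this
      rw [← this]
      exact Finset.sum_congr rfl fun v _ => by rw [map_mul, hcomp]
    have hrest : ∀ v ≠ u, aeval G (P v) * τ (indicator v.1) ∈
        idealOfVars σ (ZMod p) ^ (n + 1) := by
      intro v hv
      rw [pow_succ]
      refine Ideal.mul_mem_mul (hGn v) ?_
      rw [mem_idealOfVars_iff_constantCoeff, hτ]
      exact eval_indicator_apply_eq_zero _ _ fun h => hv (Subtype.ext h.symm)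
    have hone : aeval G (P u) * (1 - τ (indicator u.1)) ∈
        idealOfVars σ (ZMod p) ^ (n + 1) := by
      rw [pow_succ]
      refine Ideal.mul_mem_mul (hGn u) ?_
      rw [mem_idealOfVars_iff_constantCoeff, map_sub, hτ, eval_indicator_apply_eq_one]
      simp
    have hPu : aeval G (P u) ∈ idealOfVars σ (ZMod p) ^ (n + 1) := by
      have h1 : aeval G (P u) * τ (indicator u.1) ∈ idealOfVars σ (ZMod p) ^ (n + 1) := by
        rw [← Finset.add_sum_erase _ _ (Finset.mem_univ u)] at hsum
        rw [eq_neg_of_add_eq_zero_left hsum]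
        exact neg_mem (sum_mem fun v hv => hrest v (Finset.ne_of_mem_erase hv))
      convert add_mem h1 hone using 1
      ring
    refine mem_pow_of_aeval_mem_pow (G := G)
      (B := Matrix.of fun i j => -constantCoeff (τ (M j i))) (fun i => ?_) (ih u) hPu
    have h1 : (X i - ∑ j, C (Matrix.of (fun i j => -constantCoeff (τ (M j i))) i j) * G j :
        MvPolynomial σ (ZMod p)) =
        X i ^ p - ∑ j, G j * (τ (M j i) - C (constantCoeff (τ (M j i)))) := by
      have h2 := hGM i
      simp only [mul_sub, Finset.sum_sub_distrib, h2, Matrix.of_apply, map_neg, neg_mul,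
        Finset.sum_neg_distrib]
      have h3 : ∑ j, C (constantCoeff (τ (M j i))) * G j =
          ∑ j, G j * C (constantCoeff (τ (M j i))) :=
        Finset.sum_congr rfl fun j _ => mul_comm _ _
      rw [h3]
      ring
    rw [h1]
    refine sub_mem ?_ (sum_mem fun j _ => ?_)
    · exact Ideal.pow_le_pow_right (Fact.out : p.Prime).two_le
        (Ideal.pow_mem_pow (X_mem_idealOfVars i) p)
    · rw [pow_two]
      refine Ideal.mul_mem_mul (hG j) ?_
      rw [mem_idealOfVars_iff_constantCoeff]
      simp

end SimpleZeros

section Bezout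

variable {p : ℕ} [Fact p.Prime] {σ : Type*} [Fintype σ]
  {F : σ → MvPolynomial σ (ZMod p)} {M : Matrix σ σ (MvPolynomial σ (ZMod p))} {d e : σ → ℕ}

open Classical in
/-- The number of zeros is at most the rank: the interpolation polynomials of the
zeros are linearly independent over `𝔽_p[F]`. -/
theorem card_zeros_mul_card_weightLE_le (hF : ∀ j, (F j).totalDegree ≤ d j) (hd : ∀ j, 0 < d j)
    (hFM : ∀ i, ∑ j, F j * M j i = X i ^ p - X i) :
    ∃ D, ∀ m, Fintype.card {v : σ → ZMod p // ∀ j, eval v (F j) = 0} *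
      Nat.card (weightLE d m) ≤ Nat.card (weightLE (fun _ : σ => 1) (m + D)) := by
  set Z := {v : σ → ZMod p // ∀ j, eval v (F j) = 0}
  obtain ⟨D, hD⟩ := exists_mem_restrictSupport_weightLE (fun _ : σ => 1)
    (fun v : Z => (indicator v.1 : MvPolynomial σ (ZMod p)))
  refine ⟨D, fun m => ?_⟩
  let W := restrictSupport (ZMod p) (weightLE d m)
  let V := restrictSupport (ZMod p) (weightLE (fun _ : σ => 1) (m + D))
  let Ψ : (Z → W) →ₗ[ZMod p] MvPolynomial σ (ZMod p) :=
    ∑ v, (LinearMap.mulRight (ZMod p) (indicator v.1)) ∘ₗ (aeval F).toLinearMap ∘ₗ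
      W.subtype ∘ₗ LinearMap.proj v
  have hΨ : ∀ P, Ψ P = ∑ v, aeval F (P v).1 * indicator v.1 := by
    intro P
    simp [Ψ]
  have hΨV : ∀ P, Ψ P ∈ V := by
    intro P
    rw [hΨ]
    exact sum_mem fun v _ => mul_mem_restrictSupport_weightLE
      (aeval_mem_of_weightLE hF (P v).2) (hD v)
  have hinj : Function.Injective (Ψ.codRestrict V hΨV) := by
    rw [← LinearMap.ker_eq_bot, LinearMap.ker_codRestrict, LinearMap.ker_eq_bot']
    intro P hP
    rw [hΨ] at hP
    ext1 v
    exact Subtype.ext (eq_zero_of_sum_aeval_mul_indicator hFM (P := fun v => (P v).1) hP v)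
  have := (weightLE_finite (σ := σ) (d := fun _ => 1) (fun _ => one_pos) (m + D)).to_subtype
  have := (weightLE_finite hd m).to_subtype
  have : Module.Finite (ZMod p) V := Module.Finite.of_basis (basisRestrictSupport _ _)
  have : Module.Finite (ZMod p) W := Module.Finite.of_basis (basisRestrictSupport _ _)
  have h := LinearMap.finrank_le_finrank_of_injective hinj
  rwa [Module.finrank_pi_fintype, Finset.sum_const, finrank_restrictSupport,
    finrank_restrictSupport, smul_eq_mul, Finset.card_univ] at h

open Classical in
/-- The interpolation polynomials of the zeros span `𝔽_p[X]` over `𝔽_p[F]` up to a common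
denominator `c(F)`, which comes from the determinant trick. -/
theorem exists_denominator (hM : ∀ j i, (M j i).totalDegree ≤ e j)
    (hd : ∀ j, 0 < d j) (hde : ∀ j, d j + e j ≤ p)
    (hFM : ∀ i, ∑ j, F j * M j i = X i ^ p - X i) :
    ∃ (c : MvPolynomial σ (ZMod p))
      (R : (σ → Fin p) → {v : σ → ZMod p // ∀ j, eval v (F j) = 0} → MvPolynomial σ (ZMod p)),
      constantCoeff c = 1 ∧ ∀ β, aeval F c * ∏ i, X i ^ (β i : ℕ) =
        ∑ v, aeval F (R β v) * indicator v.1 := by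
  set Z := {v : σ → ZMod p // ∀ j, eval v (F j) = 0}
  let x : (σ → Fin p) → MvPolynomial σ (ZMod p) := fun β => ∏ i, X i ^ (β i : ℕ)
  have hx : ∀ f : MvPolynomial σ (ZMod p), ∃ P : (σ → Fin p) → MvPolynomial σ (ZMod p),
      f = ∑ β, aeval F (P β) * x β := by
    intro f
    obtain ⟨P, -, hP⟩ := exists_eq_sum_aeval_mul_monomial hM hd hde hFM f.totalDegree
      (mem_restrictSupport_weightLE_one.mpr le_rfl)
    exact ⟨P, by convert hP⟩
  let y : (σ → Fin p) → MvPolynomial σ (ZMod p) := fun β =>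
    ∑ v : Z, C (eval v.1 (x β)) * indicator v.1
  have hN : ∀ β, ∃ N : (σ → Fin p) → MvPolynomial σ (ZMod p), (∀ γ, constantCoeff (N γ) = 0) ∧
      x β - y β = ∑ γ, aeval F (N γ) * x γ := by
    intro β
    have hmem : x β - y β ∈ Ideal.span (Set.range F) := by
      refine mem_span_of_vanishes hFM fun v hv => ?_
      rw [map_sub, map_sum, Finset.sum_eq_single ⟨v, hv⟩]
      · simp [eval_indicator_apply_eq_one]
      · intro u _ hu
        rw [map_mul, eval_indicator_apply_eq_zero _ _ fun h => hu (Subtype.ext h.symm), mul_zero]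
      · simp
    obtain ⟨h, hh⟩ := (Ideal.mem_span_range_iff_exists_fun).mp hmem
    choose P hP using fun j => hx (h j)
    refine ⟨fun γ => ∑ j, X j * P j γ, fun γ => by simp, ?_⟩
    rw [← hh]
    simp only [map_sum, map_mul, aeval_X, Finset.sum_mul]
    rw [Finset.sum_comm]
    refine Finset.sum_congr rfl fun j _ => ?_
    conv_lhs => rw [hP j, Finset.sum_mul]
    exact Finset.sum_congr rfl fun γ _ => by ring
  choose N hN0 hN using hN
  let T : Matrix (σ → Fin p) (σ → Fin p) (MvPolynomial σ (ZMod p)) := 1 - Matrix.of N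
  let φ : MvPolynomial σ (ZMod p) →+* MvPolynomial σ (ZMod p) := (aeval F).toRingHom
  have hφ : ∀ Q, φ Q = aeval F Q := fun _ => rfl
  have hT : (φ.mapMatrix T).mulVec x = y := by
    have : φ.mapMatrix T = 1 - φ.mapMatrix (Matrix.of N) := by
      simp only [T, map_sub, map_one]
    rw [this, Matrix.sub_mulVec, Matrix.one_mulVec]
    ext1 β
    rw [Pi.sub_apply, sub_eq_iff_eq_add, ← sub_eq_iff_eq_add', hN β]
    rfl
  have hdet : φ T.det • x = (φ.mapMatrix T.adjugate).mulVec y := by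
    rw [← hT, Matrix.mulVec_mulVec, ← map_mul, Matrix.adjugate_mul]
    ext1 β
    simp [Matrix.mulVec, dotProduct, Matrix.smul_apply, Matrix.one_apply, apply_ite φ]
  refine ⟨T.det, fun β v => ∑ γ, T.adjugate β γ * C (eval v.1 (x γ)), ?_, fun β => ?_⟩
  · rw [RingHom.map_det]
    have : constantCoeff.mapMatrix T = 1 := by
      rw [map_sub, map_one, sub_eq_self]
      ext β γ
      exact hN0 β γ
    rw [this, Matrix.det_one]
  · have h1 := congrFun hdet β
    rw [Pi.smul_apply, smul_eq_mul, hφ] at h1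
    refine h1.trans ?_
    simp only [Matrix.mulVec, dotProduct, y, Finset.mul_sum, map_sum, map_mul, Finset.sum_mul,
      algHom_C, MvPolynomial.algebraMap_eq]
    rw [Finset.sum_comm]
    refine Finset.sum_congr rfl fun v _ => Finset.sum_congr rfl fun γ _ => ?_
    rw [← mul_assoc]
    rfl

open Classical in
/-- The number of zeros is at least the rank: up to the denominator `c(F)`, every polynomial
is a combination of the interpolation polynomials of the zeros. -/
theorem card_weightLE_one_le_card_zeros_mul (hM : ∀ j i, (M j i).totalDegree ≤ e j)
    (hd : ∀ j, 0 < d j) (hde : ∀ j, d j + e j ≤ p)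
    (hFM : ∀ i, ∑ j, F j * M j i = X i ^ p - X i)
    (hne : ∃ v : σ → ZMod p, ∀ j, eval v (F j) = 0) :
    ∃ D, ∀ m, Nat.card (weightLE (fun _ : σ => 1) m) ≤
      Fintype.card {v : σ → ZMod p // ∀ j, eval v (F j) = 0} *
        Nat.card (weightLE d (m + D)) := by
  set Z := {v : σ → ZMod p // ∀ j, eval v (F j) = 0}
  obtain ⟨c, R, hc, hR⟩ := exists_denominator hM hd hde hFM
  have hc0 : aeval F c ≠ 0 := by
    obtain ⟨v, hv⟩ := hne
    intro h0
    have h1 : eval v (aeval F c) = constantCoeff c := by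
      have h2 : (eval v).comp (aeval F : MvPolynomial σ (ZMod p) →ₐ[ZMod p] _).toRingHom =
          constantCoeff := by
        apply MvPolynomial.ringHom_ext
        · intro r
          simp
        · intro j
          simp [hv j]
      exact RingHom.congr_fun h2 c
    rw [h0, map_zero, hc] at h1
    exact zero_ne_one h1
  obtain ⟨D, hD⟩ := exists_mem_restrictSupport_weightLE d
    (fun βv : (σ → Fin p) × Z => R βv.1 βv.2)
  refine ⟨D, fun m => ?_⟩
  let W := restrictSupport (ZMod p) (weightLE d (m + D))
  let V := restrictSupport (ZMod p) (weightLE (fun _ : σ => 1) m)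
  let Ψ : (Z → W) →ₗ[ZMod p] MvPolynomial σ (ZMod p) :=
    ∑ v, (LinearMap.mulRight (ZMod p) (indicator v.1)) ∘ₗ (aeval F).toLinearMap ∘ₗ
      W.subtype ∘ₗ LinearMap.proj v
  have hΨ : ∀ P, Ψ P = ∑ v, aeval F (P v).1 * indicator v.1 := by
    intro P
    simp [Ψ]
  have hV : V.map (LinearMap.mulLeft (ZMod p) (aeval F c)) ≤ LinearMap.range Ψ := by
    rintro _ ⟨f, hf, rfl⟩
    obtain ⟨P, hP, hfP⟩ := exists_eq_sum_aeval_mul_monomial hM hd hde hFM m hf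
    refine ⟨fun v => ⟨∑ β, P β * R β v, sum_mem fun β _ =>
      mul_mem_restrictSupport_weightLE (hP β) (hD (β, v))⟩, ?_⟩
    rw [hΨ, LinearMap.mulLeft_apply]
    conv_rhs => rw [hfP, Finset.mul_sum]
    simp only [map_sum, map_mul, Finset.sum_mul]
    rw [Finset.sum_comm]
    refine Finset.sum_congr rfl fun β _ => ?_
    rw [mul_left_comm, hR β, Finset.mul_sum]
    exact Finset.sum_congr rfl fun v _ => mul_assoc _ _ _
  have := (weightLE_finite (σ := σ) (d := fun _ => 1) (fun _ => one_pos) m).to_subtype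
  have := (weightLE_finite hd (m + D)).to_subtype
  have : Module.Finite (ZMod p) V := Module.Finite.of_basis (basisRestrictSupport _ _)
  have : Module.Finite (ZMod p) W := Module.Finite.of_basis (basisRestrictSupport _ _)
  have h1 := Submodule.finrank_mono hV
  rw [← (Submodule.equivMapOfInjective (LinearMap.mulLeft (ZMod p) (aeval F c))
    (mul_right_injective₀ hc0) V).finrank_eq] at h1
  have h2 := h1.trans (LinearMap.finrank_range_le Ψ)
  rwa [Module.finrank_pi_fintype, Finset.sum_const, finrank_restrictSupport,
    finrank_restrictSupport, smul_eq_mul, Finset.card_univ] at h2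

open Classical in
/-- A form of Bézout's theorem: if `X i ^ p - X i = ∑ j, F j * M j i` with `F j` of degree at most
`d j` and `M j i` of degree at most `p - d j`, then the `F j` have `∏ j, d j` common zeros over
`𝔽_p`. Both numbers are the ratio of the Hilbert functions of `𝔽_p[X]` and `𝔽_p[F]`, since
`𝔽_p[X]` has rank over `𝔽_p[F]` equal to the number of zeros. -/
theorem card_zeros_eq_prod (hF : ∀ j, (F j).totalDegree ≤ d j)
    (hM : ∀ j i, (M j i).totalDegree ≤ e j) (hd : ∀ j, 0 < d j) (hde : ∀ j, d j + e j ≤ p)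
    (hFM : ∀ i, ∑ j, F j * M j i = X i ^ p - X i)
    (hne : ∃ v : σ → ZMod p, ∀ j, eval v (F j) = 0) :
    Fintype.card {v : σ → ZMod p // ∀ j, eval v (F j) = 0} = ∏ j, d j := by
  set N := Fintype.card {v : σ → ZMod p // ∀ j, eval v (F j) = 0}
  obtain ⟨D, hD⟩ := card_zeros_mul_card_weightLE_le hF hd hFM
  obtain ⟨D', hD'⟩ := card_weightLE_one_le_card_zeros_mul hM hd hde hFM hne
  have hle := fun {N P D} => le_of_mul_le_mul_shift (N := N) (P := P) (D := D)
    (card_weightLE_one_le_pow (σ := σ)) (card_weightLE_one_pos 0)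
  apply le_antisymm
  · refine hle (D := D) fun m => ?_
    calc N * Nat.card (weightLE (fun _ : σ => 1) m)
        ≤ N * ((∏ j, d j) * Nat.card (weightLE d m)) :=
          Nat.mul_le_mul_left _ (card_weightLE_one_le hd m)
      _ = (∏ j, d j) * (N * Nat.card (weightLE d m)) := by ring
      _ ≤ _ := Nat.mul_le_mul_left _ (hD m)
  · refine hle (D := D' + ∑ j, d j) fun m => ?_
    calc (∏ j, d j) * Nat.card (weightLE (fun _ : σ => 1) m)
        ≤ (∏ j, d j) * (N * Nat.card (weightLE d (m + D'))) := Nat.mul_le_mul_left _ (hD' m)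
      _ = N * ((∏ j, d j) * Nat.card (weightLE d (m + D'))) := by ring
      _ ≤ N * Nat.card (weightLE (fun _ : σ => 1) (m + (D' + ∑ j, d j))) := by
        rw [← add_assoc]
        exact Nat.mul_le_mul_left _ (card_weightLE_le (m + D'))

end Bezout

/-! ### The complement of a free arrangement over a prime field -/

section Complement

theorem totalDegree_det_le {R : Type*} [CommRing R] {σ : Type*} {l : ℕ} {r : Fin l → ℕ}
    {M : Matrix (Fin l) (Fin l) (MvPolynomial σ R)}
    (hM : ∀ k j, (M k j).totalDegree ≤ r k) : M.det.totalDegree ≤ ∑ k, r k := by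
  rw [← Matrix.det_transpose, Matrix.det_apply, ← mem_restrictTotalDegree]
  refine sum_mem fun σ _ => ?_
  rw [Units.smul_def]
  refine zsmul_mem ?_ _
  rw [mem_restrictTotalDegree]
  exact (totalDegree_finsetProd _ _).trans (Finset.sum_le_sum fun i _ => hM i (σ i))

variable {p : ℕ} [Fact p.Prime] {l : ℕ} {ι : Type*} {a : ι → Fin l → ZMod p}

theorem linForm_pow_char (b : Fin l → ZMod p) :
    linForm b ^ p = applyField b fun i => X i ^ p := by
  rw [linForm, sum_pow_char]
  refine Finset.sum_congr rfl fun i _ => ?_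
  rw [mul_pow, ← C_pow, ZMod.pow_card]

theorem applyField_X_pow_sub_X (b : Fin l → ZMod p) :
    (applyField b fun i => X i ^ p - X i) = linForm b ^ p - linForm b := by
  rw [linForm_pow_char, linForm_eq_applyField]
  simp [applyField, mul_sub]

/-- Over the prime field the vector field `∑ (x_i ^ p - x_i) ∂_i` is tangent to every
hyperplane. -/
theorem isLogField_X_pow_sub_X (a : ι → Fin l → ZMod p) :
    IsLogField a fun i => X i ^ p - X i := by
  intro i
  rw [applyField_X_pow_sub_X]
  exact dvd_sub (dvd_pow_self _ (Fact.out : p.Prime).ne_zero) dvd_rfl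

open Classical in
/-- Terao's factorization theorem over a prime field: the complement of a free arrangement with
exponents `e` has `∏ (p - e k)` points. These points are the common zeros of the coefficients of
`∑ (x_i ^ p - x_i) ∂_i` in a basis of `D(A)`. -/
theorem CentralArrangement.IsDefinedBy.card_complement_eq_prod [Fintype ι]
    {A : CentralArrangement (ZMod p) l} (h : A.IsDefinedBy a) {e : Fin l → ℕ}
    (he : A.IsFreeWithExponents e) (hlt : ∀ k, e k < p) (hcard : Fintype.card ι ≤ p) :
    (Finset.univ.filter fun v => ∀ H ∈ A.hyperplanes, v ∉ H).card = ∏ k, (p - e k) := by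
  obtain ⟨M, hM, hhom, c, hc, hdet⟩ := (h.isFreeWithExponents_iff e).mp he
  obtain ⟨F, hFM, hFdet⟩ := h.exists_sum_mul_eq hM hc hdet (isLogField_X_pow_sub_X a)
  have hdet0 := h.det_ne_zero hc hdet
  have hp := (Fact.out : p.Prime)
  have hXdeg : ∀ j : Fin l, (X j ^ p - X j : MvPolynomial (Fin l) (ZMod p)).totalDegree ≤ p := by
    intro j
    refine (totalDegree_sub _ _).trans (max_le ?_ ?_)
    · rw [totalDegree_X_pow]
    · rw [totalDegree_X]
      exact hp.one_le
  have hMdeg : ∀ k j, (M k j).totalDegree ≤ e k := fun k j => (hhom k j).totalDegree_le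
  have hFdeg : ∀ k, (F k).totalDegree ≤ p - e k := by
    intro k
    rcases eq_or_ne (F k) 0 with h0 | h0
    · simp [h0]
    have h1 := congrArg totalDegree (hFdet k)
    rw [totalDegree_mul_of_isDomain h0 hdet0, (isHomogeneous_det hhom).totalDegree hdet0] at h1
    have h2 : (M.updateRow k fun i => X i ^ p - X i).det.totalDegree ≤
        ∑ k', Function.update e k p k' := by
      refine totalDegree_det_le fun k' j => ?_
      by_cases hk : k' = k
      · subst hk
        rw [Matrix.updateRow_self, Function.update_self]
        exact hXdeg j
      · rw [Matrix.updateRow_ne hk, Function.update_of_ne hk]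
        exact hMdeg k' j
    rw [← h1, Finset.sum_update_of_mem (Finset.mem_univ k),
      ← Finset.add_sum_erase _ _ (Finset.mem_univ k), Finset.sdiff_singleton_eq_erase] at h2
    lia
  have hzero : ∀ v, (∀ H ∈ A.hyperplanes, v ∉ H) ↔ ∀ k, eval v (F k) = 0 := by
    intro v
    have hcompl : (∀ H ∈ A.hyperplanes, v ∉ H) ↔ ∀ i, eval v (linForm (a i)) ≠ 0 := by
      simp only [h.mem_iff, forall_exists_index, forall_apply_eq_imp_iff, mem_linearLocus,
        eval_linForm]
    rw [hcompl]
    constructor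
    · intro hv
      have h1 : (M.map (eval v)).det ≠ 0 := by
        have := RingHom.map_det (eval v) M
        rw [hdet, map_mul, map_prod, eval_C] at this
        rw [← RingHom.mapMatrix_apply, ← this]
        exact mul_ne_zero hc (Finset.prod_ne_zero_iff.mpr fun i _ => hv i)
      have h2 : Matrix.vecMul (fun k => eval v (F k)) (M.map (eval v)) = 0 := by
        ext1 j
        have := congrArg (eval v) (hFM j)
        simpa [Matrix.vecMul, dotProduct, ZMod.pow_card] using this
      exact congrFun (Matrix.eq_zero_of_vecMul_eq_zero h1 h2)
    · intro hv i h0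
      -- Dividing the field by the form of the hyperplane gives `α ^ (p - 1) - 1`, which
      -- is `-1` on the hyperplane.
      choose b hb using fun k => hM k i
      have h1 : linForm (a i) * (linForm (a i) ^ (p - 1) - 1) =
          linForm (a i) * ∑ k, F k * b k := by
        have h2 : applyField (a i) (fun j => X j ^ p - X j) =
            ∑ k, F k * applyField (a i) (M k) := by
          simp only [applyField, ← hFM, Finset.mul_sum]
          rw [Finset.sum_comm]
          exact Finset.sum_congr rfl fun k _ => Finset.sum_congr rfl fun j _ => by ring
        rw [applyField_X_pow_sub_X] at h2
        rw [mul_sub, ← pow_succ', Nat.sub_add_cancel hp.one_le, mul_one, h2, Finset.mul_sum]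
        exact Finset.sum_congr rfl fun k _ => by rw [hb]; ring
      have h3 := congrArg (eval v) (mul_left_cancel₀ (linForm_ne_zero (h.ne_zero i)) h1)
      rw [map_sub, map_pow, h0, map_sum, zero_pow (by have := hp.two_le; lia)] at h3
      simp [hv] at h3
  have hne : ∃ v : Fin l → ZMod p, ∀ k, eval v (F k) = 0 := by
    by_contra! hcon
    refine prod_linForm_ne_zero h (IsHomogeneous.eq_zero_of_forall_eval_eq_zero_of_le_card
      (n := Fintype.card ι) ?_ (fun v => ?_) (by simpa using hcard))
    · have := IsHomogeneous.prod Finset.univ _ _ fun i _ => isHomogeneous_linForm (a i)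
      simpa using this
    · have h1 : ¬ ∀ H ∈ A.hyperplanes, v ∉ H := by
        rw [hzero]
        push Not
        exact hcon v
      push Not at h1
      obtain ⟨H, hH, hv⟩ := h1
      obtain ⟨i, rfl⟩ := (h.mem_iff H).mp hH
      rw [map_prod]
      exact Finset.prod_eq_zero (Finset.mem_univ i) ((eval_linForm _ _).trans hv)
  rw [← card_zeros_eq_prod (F := F) (M := M) (d := fun k => p - e k) (e := e) hFdeg hMdeg
    (fun k => Nat.sub_pos_of_lt (hlt k)) (fun k => (Nat.sub_add_cancel (hlt k).le).le) hFM hne,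
    Fintype.card_subtype]
  exact congrArg _ (Finset.filter_congr fun v _ => hzero v)

end Complement

/-! ### Reduction modulo a large prime -/

open Filter

section Reduction

/-- Reduction of an integer vector to a vector over the ring `R`. -/
def castVec {l : ℕ} (R : Type*) [Ring R] (a : Fin l → ℤ) : Fin l → R :=
  Int.castRingHom R ∘ a

variable {l : ℕ}

theorem castVec_dotProduct {R : Type*} [CommRing R] (a b : Fin l → ℤ) :
    castVec R a ⬝ᵥ castVec R b = ((a ⬝ᵥ b : ℤ) : R) := by
  simp [castVec, dotProduct]

theorem eventually_intCast_ne_zero {n : ℤ} (hn : n ≠ 0) :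
    ∀ᶠ p : ℕ in atTop, (n : ZMod p) ≠ 0 := by
  filter_upwards [eventually_gt_atTop n.natAbs] with p hp h0
  rw [CharP.intCast_eq_zero_iff (ZMod p) p] at h0
  exact hp.not_ge (Nat.le_of_dvd (Int.natAbs_pos.mpr hn) (Int.natCast_dvd.mp h0))

theorem exists_castVec_eq_smul {ι : Type*} [Finite ι] (a : ι → Fin l → ℚ) :
    ∃ n : ℤ, n ≠ 0 ∧ ∃ z : ι → Fin l → ℤ, ∀ i, castVec ℚ (z i) = (n : ℚ) • a i := by
  obtain ⟨b, hb⟩ := IsLocalization.exist_integer_multiples_of_finite (nonZeroDivisors ℤ)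
    (fun ij : ι × Fin l => a ij.1 ij.2)
  choose z hz using hb
  refine ⟨b, nonZeroDivisors.coe_ne_zero b, fun i j => z (i, j), fun i => ?_⟩
  ext j
  simpa [castVec] using hz (i, j)

theorem exists_map_eq_C_mul {ι σ : Type*} [Finite ι] (f : ι → MvPolynomial σ ℚ) :
    ∃ n : ℤ, n ≠ 0 ∧ ∃ g : ι → MvPolynomial σ ℤ,
      ∀ i, map (Int.castRingHom ℚ) (g i) = C (n : ℚ) * f i := by
  classical
  have key : ∀ q : MvPolynomial σ ℚ, ∃ n : ℤ, n ≠ 0 ∧ ∃ g : MvPolynomial σ ℤ,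
      map (Int.castRingHom ℚ) g = C (n : ℚ) * q := by
    intro q
    induction q using MvPolynomial.induction_on with
    | C r =>
      refine ⟨r.den, by exact_mod_cast r.den_ne_zero, C r.num, ?_⟩
      rw [map_C, ← C_mul]
      congr 1
      simp [Rat.den_mul_eq_num]
    | add q r hq hr =>
      obtain ⟨n, hn, g, hg⟩ := hq
      obtain ⟨m, hm, h, hh⟩ := hr
      refine ⟨n * m, mul_ne_zero hn hm, C m * g + C n * h, ?_⟩
      rw [map_add, map_mul, map_mul, hg, hh, map_C, map_C, Int.cast_mul, C_mul]
      simp only [eq_intCast]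
      ring
    | mul_X q i hq =>
      obtain ⟨n, hn, g, hg⟩ := hq
      exact ⟨n, hn, g * X i, by rw [map_mul, hg, map_X, mul_assoc]⟩
  have := Fintype.ofFinite ι
  choose n hn g hg using fun i => key (f i)
  refine ⟨∏ i, n i, Finset.prod_ne_zero_iff.mpr fun i _ => hn i,
    fun i => C (∏ j ∈ Finset.univ.erase i, n j) * g i, fun i => ?_⟩
  rw [map_mul, hg, map_C, ← mul_assoc, ← C_mul, ← Finset.prod_erase_mul _ _ (Finset.mem_univ i)]
  simp

theorem linearLocus_smul {K : Type*} [Field K] {c : K} (hc : c ≠ 0) (a : Fin l → K) :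
    linearLocus (c • a) = linearLocus a :=
  le_antisymm (linearLocus_le_iff.mpr ⟨c⁻¹, inv_smul_smul₀ hc a⟩)
    (linearLocus_le_iff.mpr ⟨c, rfl⟩)

theorem CentralArrangement.exists_isDefinedBy_castVec (A : CentralArrangement ℚ l) :
    ∃ a : A.hyperplanes → Fin l → ℤ, A.IsDefinedBy fun i => castVec ℚ (a i) := by
  choose b hb using fun H : A.hyperplanes => exists_linearLocus_eq (A.isCoatom_of_mem H.1 H.2)
  obtain ⟨n, hn, a, ha⟩ := exists_castVec_eq_smul b
  have hab : ∀ i, linearLocus (castVec ℚ (a i)) = i.1 := by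
    intro i
    rw [ha, linearLocus_smul (by exact_mod_cast hn), hb]
  refine ⟨a, fun i j hij => ?_, fun H => ⟨fun hH => ⟨⟨H, hH⟩, hab _⟩, ?_⟩⟩
  · simp only [hab] at hij
    exact Subtype.ext hij
  · rintro ⟨i, rfl⟩
    rw [hab]
    exact i.2

/-- The arrangement of the zero loci of a finite family of nonzero linear forms. -/
noncomputable def CentralArrangement.ofForms {K ι : Type*} [Field K] [Finite ι]
    (a : ι → Fin l → K) (ha : ∀ i, a i ≠ 0) : CentralArrangement K l where
  hyperplanes := (Set.finite_range fun i => linearLocus (a i)).toFinset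
  isCoatom_of_mem := by
    intro H hH
    obtain ⟨i, rfl⟩ := (Set.Finite.mem_toFinset _).mp hH
    exact isCoatom_linearLocus (ha i)

theorem CentralArrangement.isDefinedBy_ofForms {K ι : Type*} [Field K] [Finite ι]
    {a : ι → Fin l → K} (ha : ∀ i, a i ≠ 0)
    (hinj : Function.Injective fun i => linearLocus (a i)) : (ofForms a ha).IsDefinedBy a where
  injective := hinj
  mem_iff H := by
    rw [ofForms, Set.Finite.mem_toFinset]
    rfl

/-- A linear dependency over `ℚ` between integer vectors persists modulo all large primes. -/
theorem eventually_mem_span_of_mem_span {ι : Type*} [Finite ι] {a : ι → Fin l → ℤ}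
    {b : Fin l → ℤ} (h : castVec ℚ b ∈ Submodule.span ℚ (Set.range fun i => castVec ℚ (a i))) :
    ∀ᶠ p : ℕ in atTop, ∀ _ : Fact p.Prime, castVec (ZMod p) b ∈
      Submodule.span (ZMod p) (Set.range fun i => castVec (ZMod p) (a i)) := by
  have := Fintype.ofFinite ι
  obtain ⟨c, hc⟩ := (Submodule.mem_span_range_iff_exists_fun ℚ).mp h
  obtain ⟨n, hn⟩ := IsLocalization.exist_integer_multiples_of_finite (nonZeroDivisors ℤ) c
  choose z hz using hn
  have hz' : ∀ i, ((z i : ℤ) : ℚ) = (n : ℤ) * c i := fun i => by simpa using hz i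
  have hrel : ∑ i, z i • a i = (n : ℤ) • b := by
    ext j
    have h1 := congrFun hc j
    have h2 : ((∑ i, z i * a i j : ℤ) : ℚ) = ((n : ℤ) * b j : ℤ) := by
      push_cast
      simp only [Finset.sum_apply, Pi.smul_apply, castVec, Function.comp_apply, eq_intCast,
        smul_eq_mul] at h1
      rw [← h1, Finset.mul_sum]
      exact Finset.sum_congr rfl fun i _ => by rw [hz', mul_assoc]
    have h3 := Int.cast_injective h2
    simpa using h3
  filter_upwards [eventually_intCast_ne_zero (nonZeroDivisors.coe_ne_zero n)] with p hp _
  have h1 : ((n : ℤ) : ZMod p) • castVec (ZMod p) b =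
      ∑ i, (z i : ZMod p) • castVec (ZMod p) (a i) := by
    ext j
    have := congrArg (Int.cast : ℤ → ZMod p) (congrFun hrel j)
    simpa [castVec] using this.symm
  rw [← inv_smul_smul₀ hp (castVec (ZMod p) b), h1]
  exact Submodule.smul_mem _ _ (Submodule.sum_mem _ fun i _ =>
    Submodule.smul_mem _ _ (Submodule.subset_span ⟨i, rfl⟩))

/-- An integer vector outside the rational span of others stays outside their span modulo all
large primes, since an integer point separates it from the span. -/
theorem eventually_notMem_span_of_notMem_span {ι : Type*} [Finite ι] {a : ι → Fin l → ℤ}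
    {b : Fin l → ℤ} (h : castVec ℚ b ∉ Submodule.span ℚ (Set.range fun i => castVec ℚ (a i))) :
    ∀ᶠ p : ℕ in atTop, ∀ _ : Fact p.Prime, castVec (ZMod p) b ∉
      Submodule.span (ZMod p) (Set.range fun i => castVec (ZMod p) (a i)) := by
  rw [← iInf_linearLocus_le_iff, SetLike.not_le_iff_exists] at h
  obtain ⟨v, hv, hvb⟩ := h
  obtain ⟨n, hn, w, hw⟩ := exists_castVec_eq_smul fun _ : Unit => v
  have hn' : (n : ℚ) ≠ 0 := by exact_mod_cast hn
  have hdot : ∀ c : Fin l → ℤ, ((c ⬝ᵥ w () : ℤ) : ℚ) = n * (castVec ℚ c ⬝ᵥ v) := by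
    intro c
    rw [← castVec_dotProduct, hw, dotProduct_smul, smul_eq_mul]
  have ha : ∀ i, a i ⬝ᵥ w () = 0 := by
    intro i
    have h1 : castVec ℚ (a i) ⬝ᵥ v = 0 := (Submodule.mem_iInf _).mp hv i
    have h2 := hdot (a i)
    rw [h1, mul_zero] at h2
    exact_mod_cast h2
  have hb : b ⬝ᵥ w () ≠ 0 := by
    intro h0
    have h2 := hdot b
    rw [h0, Int.cast_zero, eq_comm, mul_eq_zero] at h2
    exact hvb (h2.resolve_left hn')
  filter_upwards [eventually_intCast_ne_zero hb] with p hp _ hmem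
  rw [← iInf_linearLocus_le_iff] at hmem
  have h1 : castVec (ZMod p) (w ()) ∈ ⨅ i, linearLocus (castVec (ZMod p) (a i)) := by
    rw [Submodule.mem_iInf]
    intro i
    rw [mem_linearLocus, castVec_dotProduct, ha, Int.cast_zero]
  have h2 := mem_linearLocus.mp (hmem h1)
  rw [castVec_dotProduct] at h2
  exact hp h2

/-- Modulo all large primes, integer forms defining a rational arrangement define an arrangement
with the same lattice of intersections. -/
theorem CentralArrangement.IsDefinedBy.eventually_exists_orderIso {ι : Type*} [Finite ι]
    {A : CentralArrangement ℚ l} {a : ι → Fin l → ℤ} (h : A.IsDefinedBy fun i => castVec ℚ (a i)) :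
    ∀ᶠ p : ℕ in atTop, ∀ _ : Fact p.Prime, ∃ A' : CentralArrangement (ZMod p) l,
      A'.IsDefinedBy (fun i => castVec (ZMod p) (a i)) ∧
      Nonempty (A.IntersectionLattice ≃o A'.IntersectionLattice) := by
  have hspan : ∀ᶠ p : ℕ in atTop, ∀ (s : Set ι) (j : ι), ∀ _ : Fact p.Prime,
      (castVec ℚ (a j) ∈ Submodule.span ℚ (Set.range fun i : s => castVec ℚ (a i)) ↔
        castVec (ZMod p) (a j) ∈
          Submodule.span (ZMod p) (Set.range fun i : s => castVec (ZMod p) (a i))) := by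
    rw [eventually_all]
    intro s
    rw [eventually_all]
    intro j
    by_cases hj : castVec ℚ (a j) ∈ Submodule.span ℚ (Set.range fun i : s => castVec ℚ (a i))
    · filter_upwards [eventually_mem_span_of_mem_span hj] with p hp hpp
      exact iff_of_true hj (hp hpp)
    · filter_upwards [eventually_notMem_span_of_notMem_span hj] with p hp hpp
      exact iff_of_false hj (hp hpp)
  filter_upwards [hspan] with p hp hpp
  have hp := fun s j => hp s j hpp
  have hne : ∀ i, castVec (ZMod p) (a i) ≠ 0 := by
    intro i h0
    refine h.ne_zero i ?_
    have h1 := (hp ∅ i).mpr (by rw [h0]; exact zero_mem _)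
    rwa [Set.range_eq_empty, Submodule.span_empty, Submodule.mem_bot] at h1
  have hinj : Function.Injective fun i => linearLocus (castVec (ZMod p) (a i)) := by
    intro i j hij
    have key : ∀ {i j : ι}, linearLocus (castVec (ZMod p) (a i)) ≤
        linearLocus (castVec (ZMod p) (a j)) →
        linearLocus (castVec ℚ (a i)) ≤ linearLocus (castVec ℚ (a j)) := by
      intro i j hle
      rw [linearLocus_le_iff, ← Submodule.mem_span_singleton] at hle ⊢
      simpa using (hp {i} j).mpr (by simpa using hle)
    exact h.injective (le_antisymm (key hij.le) (key hij.ge))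
  have h' := isDefinedBy_ofForms hne hinj
  exact ⟨_, h', h.nonempty_orderIso h' hp⟩

end Reduction

section ReductionOfFields

variable {l : ℕ} {ι : Type*} {a : ι → Fin l → ℤ}

theorem map_linForm_castVec (R : Type*) [CommRing R] (b : Fin l → ℤ) :
    map (Int.castRingHom R) (linForm b) = linForm (castVec R b) :=
  map_linForm _ _

theorem map_applyField_castVec (R : Type*) [CommRing R] (b : Fin l → ℤ)
    (f : Fin l → MvPolynomial (Fin l) ℤ) : map (Int.castRingHom R) (applyField b f) =
      applyField (castVec R b) fun j => map (Int.castRingHom R) (f j) :=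
  map_applyField _ _ _

theorem IsLogField.map_castVec (R : Type*) [CommRing R] {f : Fin l → MvPolynomial (Fin l) ℤ}
    (h : IsLogField a f) :
    IsLogField (fun i => castVec R (a i)) fun j => map (Int.castRingHom R) (f j) := by
  intro i
  rw [← map_linForm_castVec, ← map_applyField_castVec]
  exact map_dvd _ (h i)

theorem map_castRingHom_rat_injective {σ : Type*} :
    Function.Injective (map (σ := σ) (Int.castRingHom ℚ)) :=
  map_injective _ Int.cast_injective

/-- A free rational arrangement stays free, with the same exponents, modulo all large primes: after
clearing denominators, a basis of `D(A)` reduces to vector fields satisfying Saito's criterion. -/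
theorem CentralArrangement.IsDefinedBy.eventually_isFreeWithExponents [Finite ι]
    {A : CentralArrangement ℚ l} (h : A.IsDefinedBy fun i => castVec ℚ (a i)) {e : Fin l → ℕ}
    (he : A.IsFreeWithExponents e) :
    ∀ᶠ p : ℕ in atTop, ∀ (_ : Fact p.Prime) (A' : CentralArrangement (ZMod p) l),
      A'.IsDefinedBy (fun i => castVec (ZMod p) (a i)) → A'.IsFreeWithExponents e := by
  have := Fintype.ofFinite ι
  obtain ⟨M, hM, hhom, c, hc, hdet⟩ := (h.isFreeWithExponents_iff e).mp he
  obtain ⟨n, hn, N, hN⟩ := exists_map_eq_C_mul fun kj : Fin l × Fin l => M kj.1 kj.2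
  choose b hb using hM
  obtain ⟨m, hm, B, hB⟩ := exists_map_eq_C_mul fun ki : Fin l × ι => b ki.1 ki.2
  have hlog : ∀ k i, C m * applyField (a i) (fun j => N (k, j)) =
      C n * linForm (a i) * B (k, i) := by
    intro k i
    apply map_castRingHom_rat_injective
    rw [map_mul, map_applyField_castVec, map_mul, map_mul, map_linForm_castVec, hB, map_C, map_C]
    have h1 : applyField (castVec ℚ (a i)) (fun j => map (Int.castRingHom ℚ) (N (k, j))) =
        C (n : ℚ) * applyField (castVec ℚ (a i)) (M k) := by
      simp only [hN, applyField, Finset.mul_sum]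
      exact Finset.sum_congr rfl fun j _ => by ring
    rw [h1, hb k i]
    simp only [eq_intCast]
    ring
  have hdetN : C (c.den : ℤ) * (Matrix.of fun k j => N (k, j)).det =
      C (n ^ l * c.num) * ∏ i, linForm (a i) := by
    apply map_castRingHom_rat_injective
    have h1 : (MvPolynomial.map (Int.castRingHom ℚ)).mapMatrix (Matrix.of fun k j => N (k, j)) =
        (C (n : ℚ) : MvPolynomial (Fin l) ℚ) • M := by
      ext1 k j
      exact hN (k, j)
    rw [map_mul, RingHom.map_det, h1, Matrix.det_smul, hdet, map_mul, map_prod, map_C, map_C,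
      Fintype.card_fin]
    simp only [map_linForm_castVec]
    have h2 : (C ((c.den : ℤ) : ℚ) * C c : MvPolynomial (Fin l) ℚ) = C (c.num : ℚ) := by
      rw [← C_mul]
      congr 1
      exact_mod_cast Rat.den_mul_eq_num c
    simp only [eq_intCast, Int.cast_mul, Int.cast_pow, C_mul, C_pow, ← h2]
    ring
  have hNhom : ∀ k j, (N (k, j)).IsHomogeneous (e k) := fun k j =>
    IsHomogeneous.of_map Int.cast_injective (f := Int.castRingHom ℚ) (by
      rw [hN]
      exact (hhom k j).C_mul _)
  have hcd : (c.den : ℤ) ≠ 0 := by exact_mod_cast c.den_ne_zero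
  filter_upwards [eventually_intCast_ne_zero hn, eventually_intCast_ne_zero hm,
    eventually_intCast_ne_zero hcd, eventually_intCast_ne_zero (Rat.num_ne_zero.mpr hc)]
    with p hnp hmp hdp hup _ A' h'
  refine h'.isFreeWithExponents_of_det
    (M := (MvPolynomial.map (Int.castRingHom (ZMod p))).mapMatrix (Matrix.of fun k j => N (k, j)))
    (fun k i => ?_) (fun k j => (hNhom k j).map _)
    (c := ((c.den : ℤ) : ZMod p)⁻¹ * ((n : ZMod p) ^ l * (c.num : ZMod p)))
    (mul_ne_zero (inv_ne_zero hdp) (mul_ne_zero (pow_ne_zero _ hnp) hup)) ?_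
  · have h1 := congrArg (MvPolynomial.map (Int.castRingHom (ZMod p))) (hlog k i)
    rw [map_mul, map_applyField_castVec, map_mul, map_mul, map_linForm_castVec, map_C, map_C,
      mul_right_comm, eq_intCast] at h1
    have hu : IsUnit (C (m : ZMod p) : MvPolynomial (Fin l) (ZMod p)) :=
      (isUnit_iff_ne_zero.mpr hmp).map C
    exact hu.dvd_mul_left.mp (Dvd.intro_left _ h1.symm)
  · have h1 := congrArg (MvPolynomial.map (Int.castRingHom (ZMod p))) hdetN
    rw [map_mul, RingHom.map_det, map_mul, map_prod, map_C, map_C] at h1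
    simp only [map_linForm_castVec, eq_intCast, Int.cast_mul, Int.cast_pow] at h1
    rw [C_mul, mul_assoc, ← h1, ← mul_assoc, ← C_mul, inv_mul_cancel₀ hdp, C_1, one_mul]

/-- The torsion of a finitely generated abelian group is killed by one nonzero integer, applied to
the cokernel of an inclusion. -/
theorem exists_smul_mem_of_smul_mem {Y : Type*} [AddCommGroup Y] [Module.Finite ℤ Y]
    (I : Submodule ℤ Y) :
    ∃ n : ℤ, n ≠ 0 ∧ ∀ (m : ℤ) (y : Y), m ≠ 0 → m • y ∈ I → n • y ∈ I := by
  have htors : Module.IsTorsion ℤ (Submodule.torsion ℤ (Y ⧸ I)) := Submodule.torsion_isTorsion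
  have hne := Submodule.annihilator_top_inter_nonZeroDivisors htors
  obtain ⟨n, hn, hn0⟩ := hne
  refine ⟨n, nonZeroDivisors.ne_zero hn0, fun m y hm hy => ?_⟩
  have hmem : (Submodule.Quotient.mk y : Y ⧸ I) ∈ Submodule.torsion ℤ (Y ⧸ I) := by
    rw [Submodule.mem_torsion_iff]
    refine ⟨⟨m, mem_nonZeroDivisors_of_ne_zero hm⟩, ?_⟩
    change m • (Submodule.Quotient.mk y : Y ⧸ I) = 0
    rw [← Submodule.Quotient.mk_smul, Submodule.Quotient.mk_eq_zero]
    exact hy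
  have h1 := Submodule.mem_annihilator.mp hn ⟨_, hmem⟩ trivial
  have h2 : n • (Submodule.Quotient.mk y : Y ⧸ I) = 0 := congrArg Subtype.val h1
  rwa [← Submodule.Quotient.mk_smul, Submodule.Quotient.mk_eq_zero] at h2

theorem exists_map_eq_support_subset {R S σ : Type*} [CommRing R] [CommRing S] {φ : R →+* S}
    (hφ : Function.Surjective φ) (f : MvPolynomial σ S) :
    ∃ g : MvPolynomial σ R, map φ g = f ∧ g.support ⊆ f.support := by
  classical
  refine ⟨∑ d ∈ f.support, monomial d (Function.surjInv hφ (coeff d f)), ?_, ?_⟩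
  · conv_rhs => rw [f.as_sum]
    simp [map_sum, map_monomial, Function.surjInv_eq]
  · refine support_sum.trans (Finset.biUnion_subset.mpr fun d hd => ?_)
    exact support_monomial_subset.trans (Finset.singleton_subset_iff.mpr hd)

/-- Homogeneous vector fields of degree `d` tangent to an arrangement modulo `p` lift, up to an
integer factor that does not depend on `p`, to integral ones. The fields are the kernel of an
integral linear map, and the factor kills the torsion of its cokernel. -/
theorem exists_lift_isLogField [Finite ι] (a : ι → Fin l → ℤ) (d : ℕ) :
    ∃ n : ℤ, n ≠ 0 ∧ ∀ (p : ℕ) [Fact p.Prime], (∀ i, castVec (ZMod p) (a i) ≠ 0) →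
      ∀ f : Fin l → MvPolynomial (Fin l) (ZMod p),
        IsLogField (fun i => castVec (ZMod p) (a i)) f → (∀ j, (f j).IsHomogeneous d) →
        ∃ g : Fin l → MvPolynomial (Fin l) ℤ, IsLogField a g ∧ (∀ j, (g j).IsHomogeneous d) ∧
          ∀ j, map (Int.castRingHom (ZMod p)) (g j) = C (n : ZMod p) * f j := by
  let T : ((Fin l → MvPolynomial (Fin l) ℤ) × (ι → MvPolynomial (Fin l) ℤ)) →ₗ[ℤ]
      (ι → MvPolynomial (Fin l) ℤ) :=
    { toFun := fun x i => applyField (a i) x.1 - linForm (a i) * x.2 i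
      map_add' := by
        intro x y
        ext1 i
        simp only [applyField, Prod.fst_add, Prod.snd_add, Pi.add_apply, mul_add,
          Finset.sum_add_distrib]
        ring
      map_smul' := by
        intro c x
        ext1 i
        simp only [applyField, Prod.smul_fst, Prod.smul_snd, Pi.smul_apply, mul_smul_comm,
          ← Finset.smul_sum, smul_sub, RingHom.id_apply] }
  let N : Submodule ℤ ((Fin l → MvPolynomial (Fin l) ℤ) × (ι → MvPolynomial (Fin l) ℤ)) :=
    (Submodule.pi Set.univ fun _ => homogeneousSubmodule (Fin l) ℤ d).prod ⊤
  let Y := ι → restrictTotalDegree (Fin l) ℤ (d + 1)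
  let J : Y →ₗ[ℤ] (ι → MvPolynomial (Fin l) ℤ) :=
    LinearMap.pi fun i => (restrictTotalDegree (Fin l) ℤ (d + 1)).subtype ∘ₗ LinearMap.proj i
  obtain ⟨n, hn, hnI⟩ := exists_smul_mem_of_smul_mem ((N.map T).comap J)
  refine ⟨n, hn, fun p hp ha f hf hfd => ?_⟩
  have hp0 : (p : ℤ) ≠ 0 := by exact_mod_cast hp.out.ne_zero
  choose b hb using hf
  have hbdeg : ∀ i, (b i).totalDegree ≤ d := by
    intro i
    rcases eq_or_ne (b i) 0 with h0 | h0
    · simp [h0]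
    have h1 := congrArg totalDegree (hb i)
    rw [totalDegree_mul_of_isDomain (linForm_ne_zero (ha i)) h0] at h1
    have h2 : (applyField (castVec (ZMod p) (a i)) f).IsHomogeneous d :=
      IsHomogeneous.sum _ _ _ fun j _ => (hfd j).C_mul _
    have := h2.totalDegree_le
    lia
  choose F hF hFs using fun j => exists_map_eq_support_subset
    (φ := Int.castRingHom (ZMod p)) (ZMod.ringHom_surjective _) (f j)
  choose B hB hBs using fun i => exists_map_eq_support_subset
    (φ := Int.castRingHom (ZMod p)) (ZMod.ringHom_surjective _) (b i)
  have hFd : ∀ j, (F j).IsHomogeneous d := fun j m hm =>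
    hfd j (mem_support_iff.mp (hFs j (mem_support_iff.mpr hm)))
  have hBd : ∀ i, (B i).totalDegree ≤ d := fun i =>
    (Finset.sup_mono (hBs i)).trans (hbdeg i)
  have hdvd : ∀ i, C (p : ℤ) ∣ applyField (a i) F - linForm (a i) * B i := by
    intro i
    rw [C_dvd_iff_zmod, map_sub, map_mul, map_applyField_castVec, map_linForm_castVec, hB]
    simp only [hF]
    rw [hb, sub_self]
  choose y hy using hdvd
  have hyd : ∀ i, y i ∈ restrictTotalDegree (Fin l) ℤ (d + 1) := by
    intro i
    rw [mem_restrictTotalDegree]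
    rcases eq_or_ne (y i) 0 with h0 | h0
    · simp [h0]
    have h1 := congrArg totalDegree (hy i)
    rw [totalDegree_mul_of_isDomain (by simpa using hp0) h0, totalDegree_C, zero_add] at h1
    rw [← h1]
    refine (totalDegree_sub _ _).trans (max_le ?_ ?_)
    · have h2 : (applyField (a i) F).IsHomogeneous d :=
        IsHomogeneous.sum _ _ _ fun j _ => (hFd j).C_mul _
      exact h2.totalDegree_le.trans (Nat.le_succ d)
    · refine (totalDegree_mul _ _).trans ?_
      have h2 := (isHomogeneous_linForm (a i)).totalDegree_le
      have h3 := hBd i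
      lia
  have hFN : ((F, B) : (Fin l → MvPolynomial (Fin l) ℤ) × (ι → MvPolynomial (Fin l) ℤ)) ∈ N :=
    ⟨fun j _ => hFd j, trivial⟩
  have hTF : T (F, B) = (p : ℤ) • fun i => y i := by
    ext1 i
    change applyField (a i) F - linForm (a i) * B i = (p : ℤ) • y i
    rw [hy, C_mul']
  obtain ⟨⟨G, B'⟩, hG, hTG⟩ := hnI p (fun i => ⟨y i, hyd i⟩) hp0 ⟨(F, B), hFN, hTF⟩
  have hTG' : T (G, B') = n • fun i => y i := hTG
  -- `n (F, B) - p (G, B')` is in the kernel of `T` and congruent to `n (F, B)` modulo `p`.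
  have hker : T (n • (F, B) - (p : ℤ) • (G, B')) = 0 := by
    rw [map_sub, map_smul, map_smul, hTF, hTG', smul_comm, sub_self]
  refine ⟨fun j => n • F j - (p : ℤ) • G j, fun i => ?_, fun j => ?_, fun j => ?_⟩
  · have h1 := congrFun hker i
    exact Dvd.intro _ (sub_eq_zero.mp h1).symm
  · rw [← mem_homogeneousSubmodule]
    exact sub_mem (Submodule.smul_mem _ _ (hFd j)) (Submodule.smul_mem _ _ (hG.1 j trivial))
  · simp only [zsmul_eq_mul, map_sub, map_mul, map_intCast, hF]
    simp

/-- For all large primes `p`, freeness modulo `p` implies freeness over `ℚ`, with the same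
exponents: a basis modulo `p` lifts to integral vector fields of the same degrees, whose
coefficient determinant does not vanish and has the degree required by Saito's criterion. -/
theorem CentralArrangement.IsDefinedBy.eventually_isFreeWithExponents_of_zmod [Finite ι]
    {A : CentralArrangement ℚ l} (h : A.IsDefinedBy fun i => castVec ℚ (a i)) :
    ∀ᶠ p : ℕ in atTop, ∀ (_ : Fact p.Prime) (A' : CentralArrangement (ZMod p) l),
      A'.IsDefinedBy (fun i => castVec (ZMod p) (a i)) →
      ∀ e : Fin l → ℕ, A'.IsFreeWithExponents e → A.IsFreeWithExponents e := by
  have := Fintype.ofFinite ι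
  choose n hn hlift using exists_lift_isLogField a
  have hlarge : ∀ᶠ p : ℕ in atTop, ∀ d ∈ Finset.range (Fintype.card ι + 1), (n d : ZMod p) ≠ 0 := by
    rw [eventually_all_finset]
    exact fun d _ => eventually_intCast_ne_zero (hn d)
  filter_upwards [hlarge] with p hp _ A' h' e he
  obtain ⟨M, hM, hhom, c, hc, hdet⟩ := (h'.isFreeWithExponents_iff e).mp he
  have hsum := sum_exponents_eq h' hhom hc hdet
  have hdet0 := h'.det_ne_zero hc hdet
  choose N hNlog hNhom hN using fun k => hlift (e k) p h'.ne_zero (M k) (hM k) (hhom k)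
  have hdetN : (Matrix.of N).det ≠ 0 := by
    intro h0
    have h1 := RingHom.map_det (MvPolynomial.map (Int.castRingHom (ZMod p))) (Matrix.of N)
    have h2 : (MvPolynomial.map (Int.castRingHom (ZMod p))).mapMatrix (Matrix.of N) =
        Matrix.of fun k j => C (n (e k) : ZMod p) * M k j := by
      ext1 k j
      exact hN k j
    rw [h0, map_zero, h2, Matrix.det_mul_column] at h1
    refine mul_ne_zero (Finset.prod_ne_zero_iff.mpr fun k _ => ?_) hdet0 h1.symm
    rw [Ne, C_eq_zero]
    refine hp (e k) (Finset.mem_range_succ_iff.mpr ?_)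
    rw [← hsum]
    exact Finset.single_le_sum (fun _ _ => Nat.zero_le _) (Finset.mem_univ k)
  let Q : Matrix (Fin l) (Fin l) (MvPolynomial (Fin l) ℚ) :=
    (MvPolynomial.map (Int.castRingHom ℚ)).mapMatrix (Matrix.of N)
  have hQdet : Q.det ≠ 0 := by
    rw [← RingHom.map_det]
    exact (map_ne_zero_iff _ map_castRingHom_rat_injective).mpr hdetN
  have hQhom : ∀ k j, (Q k j).IsHomogeneous (e k) := fun k j => (hNhom k j).map _
  have hQlog : ∀ k, IsLogField (fun i => castVec ℚ (a i)) (Q k) := fun k => (hNlog k).map_castVec ℚ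
  obtain ⟨u, hu⟩ := prod_linForm_dvd_det h Q hQlog
  have hu0 : u ≠ 0 := by
    rintro rfl
    exact hQdet (by rw [hu, mul_zero])
  have hP := prod_linForm_ne_zero h
  have hPhom : (∏ i, linForm (castVec ℚ (a i))).IsHomogeneous (∑ _ : ι, 1) :=
    IsHomogeneous.prod _ _ _ fun i _ => isHomogeneous_linForm _
  have hudeg : u.totalDegree = 0 := by
    have h1 := congrArg totalDegree hu
    rw [totalDegree_mul_of_isDomain hP hu0, (isHomogeneous_det hQhom).totalDegree hQdet,
      hPhom.totalDegree hP, hsum] at h1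
    simpa using h1
  obtain ⟨r, rfl⟩ : ∃ r, u = C r := ⟨_, totalDegree_eq_zero_iff_eq_C.mp hudeg⟩
  exact h.isFreeWithExponents_of_det hQlog hQhom (c := r) (by simpa using hu0)
    (by rw [hu, mul_comm])

end ReductionOfFields

/-! ### Comparison of the exponents -/

section Exponents

/-- Two families are permutations of each other if `∏ (p - e k) = ∏ (p - e' k)` for infinitely
many `p`. -/
theorem exists_perm_of_frequently_prod_eq {κ : Type*} [Fintype κ] {e e' : κ → ℕ}
    (h : ∃ᶠ p : ℕ in atTop, ∏ k, (p - e k) = ∏ k, (p - e' k)) :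
    ∃ σ : Equiv.Perm κ, ∀ k, e' (σ k) = e k := by
  classical
  have h' : ∃ᶠ p : ℕ in atTop, (∏ k, ((p : ℤ) - e k)) = ∏ k, ((p : ℤ) - e' k) := by
    refine (h.and_eventually (eventually_all.mpr fun k =>
      eventually_ge_atTop (e k + e' k))).mono fun p ⟨hp, hle⟩ => ?_
    have hcast : ∀ f : κ → ℕ, (∀ k, f k ≤ p) →
        ∏ k, ((p : ℤ) - f k) = ((∏ k, (p - f k) : ℕ) : ℤ) := by
      intro f hf
      rw [Nat.cast_prod]
      exact Finset.prod_congr rfl fun k _ => (Nat.cast_sub (hf k)).symm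
    rw [hcast e fun k => (Nat.le_add_right _ _).trans (hle k),
      hcast e' fun k => (Nat.le_add_left _ _).trans (hle k), hp]
  let P : (κ → ℕ) → Polynomial ℤ := fun f =>
    (((Finset.univ : Finset κ).val.map fun k => (f k : ℤ)).map
      fun r => Polynomial.X - Polynomial.C r).prod
  have hPeval : ∀ f (x : ℤ), (P f).eval x = ∏ k, (x - f k) := by
    intro f x
    have : P f = ∏ k, (Polynomial.X - Polynomial.C (f k : ℤ)) := by
      simp only [P, Multiset.map_map]
      rfl
    rw [this, Polynomial.eval_prod]
    simp
  have hP : P e = P e' := by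
    refine Polynomial.eq_of_infinite_eval_eq _ _ ?_
    refine ((Nat.frequently_atTop_iff_infinite.mp h').image
      (Nat.cast_injective (R := ℤ)).injOn).mono ?_
    rintro _ ⟨p, hp, rfl⟩
    change (P e).eval (p : ℤ) = (P e').eval (p : ℤ)
    rw [hPeval, hPeval]
    exact hp
  have hroots := congrArg Polynomial.roots hP
  simp only [P, Polynomial.roots_multiset_prod_X_sub_C] at hroots
  have hfib : ∀ n : ℕ, Nonempty ({k // e k = n} ≃ {k // e' k = n}) := by
    intro n
    rw [← Fintype.card_eq, Fintype.card_subtype, Fintype.card_subtype]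
    have h1 := congrArg (Multiset.count (n : ℤ)) hroots
    simpa [Multiset.count_map, Finset.card_def, eq_comm] using h1
  let σ : κ ≃ κ := (Equiv.sigmaFiberEquiv e).symm.trans
    ((Equiv.sigmaCongrRight fun n => (hfib n).some).trans (Equiv.sigmaFiberEquiv e'))
  exact ⟨σ, fun k => ((hfib (e k)).some ⟨k, rfl⟩).2⟩

theorem CentralArrangement.IsFreeWithExponents.comp_perm {K : Type*} [Field K] {l : ℕ}
    {A : CentralArrangement K l} {e e' : Fin l → ℕ} (h : A.IsFreeWithExponents e')
    (σ : Equiv.Perm (Fin l)) (hσ : ∀ k, e' (σ k) = e k) : A.IsFreeWithExponents e := by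
  obtain ⟨δ, hδ⟩ := h
  refine ⟨δ.reindex σ.symm, fun i j => ?_⟩
  rw [Module.Basis.reindex_apply, Equiv.symm_symm, ← hσ]
  exact hδ _ _

/-- Free rational arrangements with isomorphic lattices of intersections have the same exponents,
up to order: modulo every large prime `p` their complements have `∏ (p - e k)` points, and this
number is determined by the lattice. -/
theorem CentralArrangement.exists_perm_exponents {l : ℕ} {A B : CentralArrangement ℚ l}
    (hAB : Nonempty (A.IntersectionLattice ≃o B.IntersectionLattice)) {e e' : Fin l → ℕ}
    (hA : A.IsFreeWithExponents e) (hB : B.IsFreeWithExponents e') :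
    ∃ σ : Equiv.Perm (Fin l), ∀ k, e' (σ k) = e k := by
  classical
  obtain ⟨φ⟩ := hAB
  obtain ⟨a, ha⟩ := A.exists_isDefinedBy_castVec
  obtain ⟨b, hb⟩ := B.exists_isDefinedBy_castVec
  refine exists_perm_of_frequently_prod_eq ?_
  have hprime : ∃ᶠ p : ℕ in atTop, p.Prime :=
    Nat.frequently_atTop_iff_infinite.mpr Nat.infinite_setOfPred_prime
  have hlarge : ∀ᶠ p : ℕ in atTop, ∀ k, e k < p ∧ e' k < p :=
    eventually_all.mpr fun k => (eventually_gt_atTop (e k)).and (eventually_gt_atTop (e' k))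
  refine (hprime.and_eventually (ha.eventually_exists_orderIso.and
    (hb.eventually_exists_orderIso.and ((ha.eventually_isFreeWithExponents hA).and
    ((hb.eventually_isFreeWithExponents hB).and (hlarge.and
    (eventually_ge_atTop (Fintype.card A.hyperplanes + Fintype.card B.hyperplanes)))))))).mono ?_
  rintro p ⟨hp, h1, h2, h3, h4, h5, h6⟩
  have hpf : Fact p.Prime := ⟨hp⟩
  obtain ⟨A', hA', ⟨φA⟩⟩ := h1 hpf
  obtain ⟨B', hB', ⟨φB⟩⟩ := h2 hpf
  rw [← hA'.card_complement_eq_prod (h3 hpf A' hA') (fun k => (h5 k).1) (by lia),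
    ← hB'.card_complement_eq_prod (h4 hpf B' hB') (fun k => (h5 k).2) (by lia)]
  exact card_complement_eq ⟨φB.symm.trans (φ.symm.trans φA)⟩

end Exponents

/-! ### Terao's conjecture over the rational numbers -/

/-- Freeness is transferred from `A` to `B` through their reductions modulo one large prime. -/
theorem isFree_of_teraoConjecture_zmod
    (hTerao : ∀ (p : ℕ) [Fact p.Prime], TeraoConjecture (ZMod p)) {l : ℕ}
    {A B : CentralArrangement ℚ l}
    (hAB : Nonempty (A.IntersectionLattice ≃o B.IntersectionLattice)) (hA : A.IsFree) :
    B.IsFree := by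
  obtain ⟨φ⟩ := hAB
  obtain ⟨e, he⟩ := hA
  obtain ⟨a, ha⟩ := A.exists_isDefinedBy_castVec
  obtain ⟨b, hb⟩ := B.exists_isDefinedBy_castVec
  have hprime : ∃ᶠ p : ℕ in atTop, p.Prime :=
    Nat.frequently_atTop_iff_infinite.mpr Nat.infinite_setOfPred_prime
  obtain ⟨p, hp, h1, h2, h3, h4⟩ := (hprime.and_eventually
    (ha.eventually_exists_orderIso.and (hb.eventually_exists_orderIso.and
    ((ha.eventually_isFreeWithExponents he).and
    hb.eventually_isFreeWithExponents_of_zmod)))).exists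
  have hpf : Fact p.Prime := ⟨hp⟩
  obtain ⟨A', hA', ⟨φA⟩⟩ := h1 hpf
  obtain ⟨B', hB', ⟨φB⟩⟩ := h2 hpf
  obtain ⟨e', he'⟩ := hTerao p l A' B' ⟨φA.symm.trans (φ.trans φB)⟩ ⟨e, h3 hpf A' hA'⟩
  exact ⟨e', h4 hpf B' hB' e' he'⟩

theorem mainTheorem2
    (hTerao : ∀ (p : ℕ) [Fact p.Prime], TeraoConjecture (ZMod p)) :
    TeraoConjecture ℚ ∧
      ∀ (l : ℕ) (A B : CentralArrangement ℚ l),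
        Nonempty (A.IntersectionLattice ≃o B.IntersectionLattice) →
          ∀ e : Fin l → ℕ, A.IsFreeWithExponents e → B.IsFreeWithExponents e := by
  refine ⟨fun l A B hAB hA => isFree_of_teraoConjecture_zmod hTerao hAB hA,
    fun l A B hAB e hA => ?_⟩
  obtain ⟨e', hB⟩ := isFree_of_teraoConjecture_zmod hTerao hAB ⟨e, hA⟩
  obtain ⟨σ, hσ⟩ := CentralArrangement.exists_perm_exponents hAB hA hB
  exact hB.comp_perm σ hσ
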